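/- \textbf{Model.} Let $r\in(1,2)$, let $\rho$ be the output fidelity, and let $\theta\in(0,1)$ be the propensity. In one round a latent mode, common to two sellers, is $H$ with probability $\theta$ and $L$ with probability $1-\theta$. Given the mode, each seller independently plays the mode with probability $\rho$ and the other action with probability $1-\rho$. The profits $(\Pi_1,\Pi_2)$ are $(2r,2r)$ for actions $(H,H)$, $(r,2+r)$ for $(H,L)$, $(2+r,r)$ for $(L,H)$ and $(2,2)$ for $(L,L)$. Let $S$ and $\Pi$ be the action and the profit of a uniformly sampled seller, and put $$\Delta(\theta)=\mathbb E[\Pi\mid S=H,\theta]-\mathbb E[\Pi\mid S=L,\theta],\qquad p_H(\theta)=\theta\rho+(1-\theta)(1-\rho),\qquad p_L(\theta)=1-p_H(\theta).$$ Fix step sizes $\gamma_n=\eta/(n+1)^\alpha$ with $\alpha\in(1/2,1]$ and $\eta\in(0,1]$. Let $\sigma(z)=1/(1+e^{-z})$. For a batch size $b\ge1$ and $\theta_0\in(0,1)$ put $z_0=\log(\theta_0/(1-\theta_0))$ and $$z_{n+1}=z_n+\gamma_n\overline D_n^{(b)},\qquad \theta_n=\sigma(z_n),\qquad \overline D_n^{(b)}=\frac1{2b}\sum_{\ell=1}^b\sum_{i=1}^2\Bigl(\frac{\Pi_i^{(\ell)}}{p_H(\theta_n)}\mathbf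 1\{S_i^{(\ell)}=H\}-\frac{\Pi_i^{(\ell)}}{p_L(\theta_n)}\mathbf 1\{S_i^{(\ell)}=L\}\Bigr),$$ where, given the past, $(S_i^{(\ell)},\Pi_i^{(\ell)})_{i=1,2}$, $\ell=1,\dots,b$, are the actions and profits of $b$ independent rounds with propensity $\theta_n$. Let $z_0^{\det}=z_0$ and $z^{\det}_{n+1}=z^{\det}_n+\gamma_n\Delta(\sigma(z^{\det}_n))$. With $t_n=\sum_{k<n}\gamma_k$, let $\bar z$ and $\bar z^{\det}$ be the piecewise-linear functions on $[0,\infty)$, with nodes $t_n$, such that $\bar z(t_n)=z_n$ and $\bar z^{\det}(t_n)=z_n^{\det}$. Put $\bar\theta=\sigma\circ\bar z$ and $\theta^{\det}=\sigma\circ\bar z^{\det}$. Finally let $$\rho_c(r)=\frac{1+\sqrt{(2-r)/r}}2,\qquad s(\rho,r)=\frac{2(2-r)\rho(1-\rho)}{(r-1)(2\rho-1)^2},\qquad \theta_\pm=\frac12\pm\frac12\sqrt{1-s(\rho,r)},$$ $$p_+(b,\theta_0)=\mathbb P\Bigl(\lim_{n\to\infty}\theta_n=\theta_+\Bigr).$$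 \textbf{Proposition (Equilibrium Selection and the Effect of Batch Size).} Let $r\in(1,2)$, $\rho\in(\rho_c(r),1)$, $\alpha\in(1/2,1]$ and $\eta\in(0,1]$. (i) For every $T>0$ there is a constant $C=C(T,\rho,r,\alpha,\eta)<\infty$ such that for all $b\ge1$, all $\theta_0\in(0,1)$ and all $\varepsilon>0$, $$\mathbb P\Bigl(\sup_{0\le t\le T}|\bar\theta(t)-\theta^{\det}(t)|>\varepsilon\Bigr)\le\frac{C}{b\,\varepsilon^2}.$$ In particular $\sup_{0\le t\le T}|\bar\theta(t)-\theta^{\det}(t)|=O_p(1/\sqrt b)$: for every $T>0$ and $\kappa>0$ there is $M$ such that, for all $b\ge1$ and all $\theta_0\in(0,1)$, this supremum exceeds $M/\sqrt b$ with probability at most $\kappa$. (ii) For every $\delta\in(0,1/2)$ there are constants $c_\delta>0$ and $C_\delta<\infty$ such that for all $b\ge1$: $1-p_+(b,\theta_0)\le C_\delta e^{-c_\delta b\delta^2}$ for all $\theta_0\in[\theta_-+\delta,1-\delta]$, and $p_+(b,\theta_0)\le C_\delta e^{-c_\delta b\delta^2}$ for all $\theta_0\in[\delta,\theta_--\delta]$.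 Consequently, for every $\theta_0\in(0,1)$ with $\theta_0\ne\theta_-$, $\lim_{b\to\infty}p_+(b,\theta_0)=\mathbf 1\{\theta_0>\theta_-\}$. (iii) For every $\epsilon\in(0,1/2)$ and every $\delta_0\in(0,1/2)$ with $\theta_-\in(\delta_0,1-\delta_0)$ there is $K=K(\rho,r,\alpha,\eta,\epsilon,\delta_0)>0$ such that for all $b\ge1$ and all $\theta_0\in[\delta_0,1-\delta_0]$, if $p_+(b,\theta_0)\in(\epsilon,1-\epsilon)$ then $|\theta_0-\theta_-|\le K/\sqrt b$. -/

import Mathlib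

open MeasureTheory Filter Topology Set

noncomputable section

namespace LLMPricing

/-! ### The pricing game and the recommendations of the model -/

/-- A pricing action (and also a latent mode): `true` is the high price `H`, `false` is the low
price `L`. -/
abbrev Action := Bool

/-- Profit of a seller who plays `s` against an opponent who plays `s'`. -/
def payoff (r : ℝ) : Action → Action → ℝ
  | true, true => 2 * r
  | true, false => r
  | false, true => 2 + r
  | false, false => 2

/-- Probability that a seller is recommended `s` when the latent mode is `m`. -/
def outputProb (ρ : ℝ) (m s : Action) : ℝ := if s = m then ρ else 1 - ρ

/-- Joint probability of the recommendations `(s 0, s 1)`: the mode is `H` with probability `θ` and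
the two outputs are conditionally independent given the mode. -/
def jointProb (ρ θ : ℝ) (s : Fin 2 → Action) : ℝ :=
  θ * ∏ i, outputProb ρ true (s i) + (1 - θ) * ∏ i, outputProb ρ false (s i)

/-- Marginal probability that a seller is recommended `H`. -/
def probH (ρ θ : ℝ) : ℝ := θ * ρ + (1 - θ) * (1 - ρ)

/-- Marginal probability that a seller is recommended `L`. -/
def probL (ρ θ : ℝ) : ℝ := 1 - probH ρ θ

/-- Profit of seller `i` under the action profile `s`; the opponent of `i` is `i + 1` modulo 2. -/
def profit (r : ℝ) (s : Fin 2 → Action) (i : Fin 2) : ℝ := payoff r (s i) (s (i + 1))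

/-- Conditional expected profit of a uniformly sampled seller, given that this seller's action
is `a`. -/
def condProfit (r ρ θ : ℝ) (a : Action) : ℝ :=
  (∑ s : Fin 2 → Action, jointProb ρ θ s *
      ((1 / 2) * ∑ i, if s i = a then profit r s i else 0)) /
    (∑ s : Fin 2 → Action, jointProb ρ θ s * ((1 / 2) * ∑ i, if s i = a then 1 else 0))

/-- The conditional payoff difference `Δ(θ)`. -/
def payoffDiff (r ρ θ : ℝ) : ℝ := condProfit r ρ θ true - condProfit r ρ θ false

/-! ### Thresholds -/

/-- The statistic `s(ρ, r)`. -/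
def driftStat (r ρ : ℝ) : ℝ := 2 * (2 - r) * ρ * (1 - ρ) / ((r - 1) * (2 * ρ - 1) ^ 2)

/-- The unstable interior equilibrium `θ₋`. -/
def thetaMinus (r ρ : ℝ) : ℝ := 1 / 2 - 1 / 2 * √(1 - driftStat r ρ)

/-- The stable interior equilibrium `θ₊`. -/
def thetaPlus (r ρ : ℝ) : ℝ := 1 / 2 + 1 / 2 * √(1 - driftStat r ρ)

/-- The critical output fidelity `ρ_c(r)`. -/
def criticalFidelity (r : ℝ) : ℝ := (1 + √((2 - r) / r)) / 2

/-! ### The data: an infinite i.i.d. stream of interaction rounds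

All randomness comes from independent uniform variables on `[0, 1]`. For the retraining step `n` and
the round `ℓ`, the variable with index `(n, ℓ, none)` determines the latent mode, and the variable
with index `(n, ℓ, some i)` determines whether the output given to seller `i` agrees with the mode.
A batch of size `b` consists of the rounds `ℓ < b`. -/

/-- The sample space. -/
abbrev Sample := ℕ × ℕ × Option (Fin 2) → unitInterval

/-- The law of the i.i.d. uniform family. -/
def sampleMeasure : Measure Sample :=
  Measure.infinitePi (fun _ : ℕ × ℕ × Option (Fin 2) => (volume : Measure unitInterval))

/-- The latent mode in round `ℓ` of batch `n`: `H` with probability `θ`. -/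
def mode (θ : ℝ) (ω : Sample) (n ℓ : ℕ) : Action :=
  if (ω (n, ℓ, none) : ℝ) < θ then true else false

/-- The actions of the two sellers in round `ℓ` of batch `n`: independently for the two sellers, the
recommendation agrees with the latent mode with probability `ρ`. -/
def actions (ρ θ : ℝ) (ω : Sample) (n ℓ : ℕ) (i : Fin 2) : Action :=
  if (ω (n, ℓ, some i) : ℝ) < ρ then mode θ ω n ℓ else !(mode θ ω n ℓ)

/-! ### Inverse probability weighting and the stochastic recursion -/

/-- The inverse probability weighting estimator `D(θ)` from an action and its profit. -/
def ipw (ρ θ : ℝ) (a : Action) (π : ℝ) : ℝ :=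
  π / probH ρ θ * (if a = true then 1 else 0) - π / probL ρ θ * (if a = false then 1 else 0)

/-- The batch average of the estimator over `b` rounds and both sellers at propensity `θ`. -/
def batchAverage (r ρ : ℝ) (b : ℕ) (θ : ℝ) (ω : Sample) (n : ℕ) : ℝ :=
  1 / (2 * (b : ℝ)) * ∑ ℓ ∈ Finset.range b, ∑ i : Fin 2,
    ipw ρ θ (actions ρ θ ω n ℓ i) (profit r (actions ρ θ ω n ℓ) i)

/-- The step sizes `γ_n = η / (n + 1) ^ α`. -/
def stepSize (α η : ℝ) (n : ℕ) : ℝ := η / ((n : ℝ) + 1) ^ α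

/-- The log-odds of a propensity. -/
def logOdds (θ : ℝ) : ℝ := Real.log (θ / (1 - θ))

/-- The stochastic log-odds recursion with batch size `b`, started at the log-odds of `θ₀`. -/
def logOddsPath (r ρ α η : ℝ) (b : ℕ) (θ₀ : ℝ) (ω : Sample) : ℕ → ℝ
  | 0 => logOdds θ₀
  | n + 1 => logOddsPath r ρ α η b θ₀ ω n +
      stepSize α η n * batchAverage r ρ b (Real.sigmoid (logOddsPath r ρ α η b θ₀ ω n)) ω n

/-- The deterministic (large-batch) log-odds recursion. -/
def detLogOddsPath (r ρ α η θ₀ : ℝ) : ℕ → ℝ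
  | 0 => logOdds θ₀
  | n + 1 => detLogOddsPath r ρ α η θ₀ n +
      stepSize α η n * payoffDiff r ρ (Real.sigmoid (detLogOddsPath r ρ α η θ₀ n))

/-- The collusion probability `p₊(b, θ₀)`: the probability that `θ_n = σ(z_n)` tends to `θ₊`. -/
def collusionProb (r ρ α η : ℝ) (b : ℕ) (θ₀ : ℝ) : ℝ :=
  sampleMeasure.real
    {ω | Tendsto (fun n => Real.sigmoid (logOddsPath r ρ α η b θ₀ ω n)) atTop
      (𝓝 (thetaPlus r ρ))}

/-! ### Continuous-time interpolation -/

/-- The times `t_n = ∑_{k < n} γ_k`. -/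
def stepTime (γ : ℕ → ℝ) (n : ℕ) : ℝ := ∑ k ∈ Finset.range n, γ k

/-- The piecewise-linear function on `[0, ∞)` that takes the value `z n` at the time `t_n`; the index
used at time `t` is the largest `n` with `t_n ≤ t`. -/
def interpolate (γ z : ℕ → ℝ) (t : ℝ) : ℝ :=
  let n := sSup {n : ℕ | stepTime γ n ≤ t}
  z n + (t - stepTime γ n) / γ n * (z (n + 1) - z n)

/-- The supremum over `0 ≤ t ≤ T` of the distance between the interpolated stochastic path and the
interpolated deterministic path, both mapped from log-odds to propensities by `σ`. -/
def pathDeviation (r ρ α η : ℝ) (b : ℕ) (θ₀ T : ℝ) (ω : Sample) : ℝ :=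
  ⨆ t : Icc (0 : ℝ) T,
    |Real.sigmoid (interpolate (stepSize α η) (logOddsPath r ρ α η b θ₀ ω) t) -
      Real.sigmoid (interpolate (stepSize α η) (detLogOddsPath r ρ α η θ₀) t)|

end LLMPricing

end

namespace LLMPricing

/-! ### Splicing two independent samples -/

instance : IsProbabilityMeasure sampleMeasure := by
  unfold sampleMeasure; infer_instance

/-- The sample which agrees with `x.1` on the indices satisfying `p` and with `x.2` elsewhere. -/
def splice (p : ℕ × ℕ × Option (Fin 2) → Prop) [DecidablePred p] (x : Sample × Sample) : Sample :=
  fun i => if p i then x.1 i else x.2 i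

lemma measurable_splice (p : ℕ × ℕ × Option (Fin 2) → Prop) [DecidablePred p] :
    Measurable (splice p) := by
  refine measurable_pi_lambda _ fun i => ?_
  unfold splice
  split_ifs <;> fun_prop

lemma map_splice (p : ℕ × ℕ × Option (Fin 2) → Prop) [DecidablePred p] :
    (sampleMeasure.prod sampleMeasure).map (splice p) = sampleMeasure := by
  refine Measure.eq_infinitePi _ fun s t ht => ?_
  have hset : splice p ⁻¹' (Set.pi s t) =
      (Set.pi (s.filter p : Finset _) t) ×ˢ (Set.pi (s.filter (fun i => ¬ p i) : Finset _) t) := by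
    ext x
    simp only [mem_preimage, Set.mem_pi, mem_prod, Finset.coe_filter, mem_ofPred_eq, splice,
      Finset.mem_coe]
    constructor
    · intro h
      refine ⟨fun i hi => ?_, fun i hi => ?_⟩
      · simpa [hi.2] using h i hi.1
      · simpa [hi.2] using h i hi.1
    · rintro ⟨h1, h2⟩ i hi
      by_cases hp : p i
      · simpa [hp] using h1 i ⟨hi, hp⟩
      · simpa [hp] using h2 i ⟨hi, hp⟩
  rw [Measure.map_apply (measurable_splice p)
      (MeasurableSet.pi s.countable_toSet fun i _ => ht i), hset, Measure.prod_prod]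
  unfold sampleMeasure
  rw [Measure.infinitePi_pi _ fun i _ => ht i, Measure.infinitePi_pi _ fun i _ => ht i]
  exact Finset.prod_filter_mul_prod_filter_not s p _

lemma lintegral_splice (p : ℕ × ℕ × Option (Fin 2) → Prop) [DecidablePred p]
    {f : Sample → ENNReal} (hf : Measurable f) :
    ∫⁻ ω, f ω ∂sampleMeasure =
      ∫⁻ ω, ∫⁻ ω', f (splice p (ω, ω')) ∂sampleMeasure ∂sampleMeasure := by
  conv_lhs => rw [← map_splice p]
  rw [lintegral_map hf (measurable_splice p)]
  exact lintegral_prod _ (hf.comp (measurable_splice p)).aemeasurable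

/-! ### The law of one round -/

lemma sum_profiles (f : (Fin 2 → Action) → ℝ) :
    ∑ s, f s = f ![true, true] + f ![true, false] + f ![false, true] + f ![false, false] := by
  rw [← (finTwoArrowEquiv Bool).symm.sum_comp, Fintype.sum_prod_type]
  simp only [Fintype.sum_bool]
  simp [finTwoArrowEquiv, add_assoc]

/-- The average over both sellers of the estimator at the action profile `s`. -/
noncomputable def profileEstimate (r ρ θ : ℝ) (s : Fin 2 → Action) : ℝ :=
  1 / 2 * ∑ i : Fin 2, ipw ρ θ (s i) (profit r s i)

lemma batchAverage_eq (r ρ : ℝ) (b : ℕ) (θ : ℝ) (ω : Sample) (n : ℕ) :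
    batchAverage r ρ b θ ω n =
      (b : ℝ)⁻¹ * ∑ ℓ ∈ Finset.range b, profileEstimate r ρ θ (actions ρ θ ω n ℓ) := by
  simp only [batchAverage, profileEstimate, ← Finset.mul_sum]
  rw [← mul_assoc]; congr 1; simp

lemma probH_bounds {ρ θ : ℝ} (hρ : ρ ∈ Ioo (1 / 2 : ℝ) 1) (hθ : θ ∈ Ioo (0 : ℝ) 1) :
    1 - ρ ≤ probH ρ θ ∧ 1 - ρ ≤ probL ρ θ := by
  obtain ⟨h1, h2⟩ := hρ
  obtain ⟨h3, h4⟩ := hθ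
  unfold probL probH
  constructor <;> nlinarith

lemma abs_ipw_le {r ρ θ : ℝ} (hr : r ∈ Ioo (1 : ℝ) 2) (hρ : ρ ∈ Ioo (1 / 2 : ℝ) 1)
    (hθ : θ ∈ Ioo (0 : ℝ) 1) (a a' : Action) :
    |ipw ρ θ a (payoff r a a')| ≤ 4 / (1 - ρ) := by
  obtain ⟨hH, hL⟩ := probH_bounds hρ hθ
  have h0 : 0 < 1 - ρ := by linarith [hρ.2]
  have hpay : 0 ≤ payoff r a a' ∧ payoff r a a' ≤ 4 := by
    obtain ⟨h1, h2⟩ := hr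
    cases a <;> cases a' <;> simp only [payoff] <;> constructor <;> linarith
  cases a
  · simp only [ipw, Bool.false_eq_true, if_false, mul_zero, if_true, mul_one, zero_sub, abs_neg]
    rw [abs_of_nonneg (div_nonneg hpay.1 (h0.le.trans hL))]
    exact div_le_div₀ (by norm_num) hpay.2 h0 hL
  · simp only [ipw, if_true, mul_one, Bool.true_eq_false, if_false, mul_zero, sub_zero]
    rw [abs_of_nonneg (div_nonneg hpay.1 (h0.le.trans hH))]
    exact div_le_div₀ (by norm_num) hpay.2 h0 hH

lemma abs_profileEstimate_le {r ρ θ : ℝ} (hr : r ∈ Ioo (1 : ℝ) 2) (hρ : ρ ∈ Ioo (1 / 2 : ℝ) 1)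
    (hθ : θ ∈ Ioo (0 : ℝ) 1) (s : Fin 2 → Action) :
    |profileEstimate r ρ θ s| ≤ 4 / (1 - ρ) := by
  have h0 := abs_ipw_le hr hρ hθ (s 0) (s (0 + 1))
  have h1 := abs_ipw_le hr hρ hθ (s 1) (s (1 + 1))
  rw [profileEstimate, Fin.sum_univ_two]
  unfold profit
  rw [abs_le] at *
  constructor <;> linarith [h0.1, h0.2, h1.1, h1.2]

lemma sum_jointProb_mul_profileEstimate {r ρ θ : ℝ} (hρ : ρ ∈ Ioo (1 / 2 : ℝ) 1)
    (hθ : θ ∈ Ioo (0 : ℝ) 1) :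
    ∑ s, jointProb ρ θ s * profileEstimate r ρ θ s = payoffDiff r ρ θ := by
  obtain ⟨hH, hL⟩ := probH_bounds hρ hθ
  have h0 : 0 < 1 - ρ := by linarith [hρ.2]
  have eH : ∑ s : Fin 2 → Action, jointProb ρ θ s * ((1 / 2) * ∑ i, if s i = true then 1 else 0)
      = probH ρ θ := by
    rw [sum_profiles]
    simp only [Fin.sum_univ_two]
    simp [jointProb, outputProb, probH]; ring
  have eL : ∑ s : Fin 2 → Action, jointProb ρ θ s * ((1 / 2) * ∑ i, if s i = false then 1 else 0)
      = probL ρ θ := by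
    rw [sum_profiles]
    simp only [Fin.sum_univ_two]
    simp [jointProb, outputProb, probL, probH]; ring
  have hH0 : probH ρ θ ≠ 0 := by linarith
  have hL0 : probL ρ θ ≠ 0 := by linarith
  rw [payoffDiff, condProfit, condProfit, eH, eL, div_sub_div _ _ hH0 hL0,
    eq_div_iff (mul_ne_zero hH0 hL0), sum_profiles, sum_profiles, sum_profiles]
  simp [profileEstimate, ipw, profit]
  field_simp
  ring

lemma payoffDiff_eq {r ρ θ : ℝ} (hρ : ρ ∈ Ioo (1 / 2 : ℝ) 1) (hθ : θ ∈ Ioo (0 : ℝ) 1) :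
    payoffDiff r ρ θ = 2 * r - 2 -
      r * (ρ * (1 - ρ)) / (ρ * (1 - ρ) + (2 * ρ - 1) ^ 2 * (θ * (1 - θ))) := by
  obtain ⟨hH, hL⟩ := probH_bounds hρ hθ
  have h0 : 0 < 1 - ρ := by linarith [hρ.2]
  have e : ρ * (1 - ρ) + (2 * ρ - 1) ^ 2 * (θ * (1 - θ)) = probH ρ θ * probL ρ θ := by
    unfold probL probH; ring
  have hH0 : probH ρ θ ≠ 0 := by linarith
  have hL0 : probL ρ θ ≠ 0 := by linarith
  rw [e, ← sum_jointProb_mul_profileEstimate hρ hθ, sum_profiles]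
  have e1 : probL ρ θ = 1 - probH ρ θ := rfl
  simp [profileEstimate, ipw, profit, payoff, jointProb, outputProb]
  field_simp
  rw [e1]
  unfold probH
  ring

lemma volume_coe_lt {x : ℝ} (hx : x ∈ Icc (0 : ℝ) 1) :
    (volume : Measure unitInterval).real {y | (y : ℝ) < x} = x := by
  have := unitInterval.volume_Iio ⟨x, hx⟩
  rw [measureReal_def, show {y : unitInterval | (y : ℝ) < x} = Iio ⟨x, hx⟩ from rfl, this,
    ENNReal.toReal_ofReal hx.1]

lemma volume_le_coe {x : ℝ} (hx : x ∈ Icc (0 : ℝ) 1) :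
    (volume : Measure unitInterval).real {y | ¬ (y : ℝ) < x} = 1 - x := by
  have h := measureReal_compl (μ := (volume : Measure unitInterval))
    (s := {y | (y : ℝ) < x}) (measurableSet_lt measurable_subtype_coe measurable_const)
  rw [volume_coe_lt hx] at h
  simpa [compl_def] using h

/-- The finite-dimensional box of samples whose round `(n, ℓ)` has mode `m` and actions `s`. -/
def roundBox (ρ θ : ℝ) (m : Action) (s : Fin 2 → Action) (i : ℕ × ℕ × Option (Fin 2)) :
    Set unitInterval :=
  match i.2.2 with
  | none => if m = true then {y | (y : ℝ) < θ} else {y | ¬ (y : ℝ) < θ}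
  | some j => if s j = m then {y | (y : ℝ) < ρ} else {y | ¬ (y : ℝ) < ρ}

lemma measurableSet_roundBox (ρ θ : ℝ) (m : Action) (s : Fin 2 → Action)
    (i : ℕ × ℕ × Option (Fin 2)) : MeasurableSet (roundBox ρ θ m s i) := by
  have h (x : ℝ) : MeasurableSet {y : unitInterval | (y : ℝ) < x} :=
    measurableSet_lt measurable_subtype_coe measurable_const
  obtain ⟨n, ℓ, _ | j⟩ := i <;> simp only [roundBox] <;> split_ifs
  exacts [h θ, (h θ).compl, h ρ, (h ρ).compl]

/-- The indices of the variables that drive the round `(n, ℓ)`. -/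
def roundIndices (n ℓ : ℕ) : Finset (ℕ × ℕ × Option (Fin 2)) :=
  Finset.univ.image fun o : Option (Fin 2) => (n, ℓ, o)

lemma mem_pi_roundBox_iff (ρ θ : ℝ) (m : Action) (s : Fin 2 → Action) (n ℓ : ℕ) (ω : Sample) :
    ω ∈ Set.pi (roundIndices n ℓ) (roundBox ρ θ m s) ↔
      mode θ ω n ℓ = m ∧ actions ρ θ ω n ℓ = s := by
  have h1 : ω ∈ Set.pi (roundIndices n ℓ) (roundBox ρ θ m s) ↔
      ω (n, ℓ, none) ∈ roundBox ρ θ m s (n, ℓ, none) ∧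
        ∀ j, ω (n, ℓ, some j) ∈ roundBox ρ θ m s (n, ℓ, some j) := by
    rw [← Option.forall (p := fun o => ω (n, ℓ, o) ∈ roundBox ρ θ m s (n, ℓ, o))]
    simp only [Set.mem_pi, roundIndices, Finset.coe_image, Finset.coe_univ, image_univ, mem_range,
      forall_exists_index, forall_apply_eq_imp_iff]
  have h2 : ω (n, ℓ, none) ∈ roundBox ρ θ m s (n, ℓ, none) ↔ mode θ ω n ℓ = m := by
    simp only [roundBox, mode]
    cases m <;> by_cases h : (ω (n, ℓ, none) : ℝ) < θ <;> simp [h, not_lt.1]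
  rw [h1, h2, funext_iff]
  refine and_congr_right fun hm => forall_congr' fun j => ?_
  simp only [roundBox, actions, hm]
  cases m <;> cases hs : s j <;> by_cases h : (ω (n, ℓ, some j) : ℝ) < ρ <;> simp [h, not_lt.1]

lemma measure_pi_roundBox {ρ θ : ℝ} (hρ : ρ ∈ Icc (0 : ℝ) 1) (hθ : θ ∈ Icc (0 : ℝ) 1)
    (m : Action) (s : Fin 2 → Action) (n ℓ : ℕ) :
    sampleMeasure.real (Set.pi (roundIndices n ℓ) (roundBox ρ θ m s)) =
      (if m = true then θ else 1 - θ) * ∏ i, outputProb ρ m (s i) := by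
  rw [measureReal_def, sampleMeasure,
    Measure.infinitePi_pi _ fun i _ => measurableSet_roundBox ρ θ m s i, ENNReal.toReal_prod,
    roundIndices, Finset.prod_image (by intro a _ c _ h; simpa using h), Fintype.prod_option]
  simp only [← measureReal_def]
  congr 1
  · simp only [roundBox]
    split_ifs
    exacts [volume_coe_lt hθ, volume_le_coe hθ]
  · refine Finset.prod_congr rfl fun j _ => ?_
    simp only [roundBox, outputProb]
    split_ifs
    exacts [volume_coe_lt hρ, volume_le_coe hρ]

lemma integral_comp_actions {ρ θ : ℝ} (hρ : ρ ∈ Icc (0 : ℝ) 1) (hθ : θ ∈ Icc (0 : ℝ) 1)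
    (n ℓ : ℕ) (f : (Fin 2 → Action) → ℝ) :
    ∫ ω, f (actions ρ θ ω n ℓ) ∂sampleMeasure = ∑ s, jointProb ρ θ s * f s := by
  have hbox (m : Action) (s : Fin 2 → Action) :
      MeasurableSet (Set.pi (roundIndices n ℓ : Set _) (roundBox ρ θ m s)) :=
    MeasurableSet.pi (roundIndices n ℓ).countable_toSet fun i _ => measurableSet_roundBox ρ θ m s i
  have hf (ω : Sample) : f (actions ρ θ ω n ℓ) = ∑ s : Fin 2 → Action, ∑ m : Action,
      (Set.pi (roundIndices n ℓ : Set _) (roundBox ρ θ m s)).indicator (fun _ => f s) ω := by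
    classical
    simp only [Set.indicator_apply, mem_pi_roundBox_iff, ite_and]
    simp
  have hint (m : Action) (s : Fin 2 → Action) : Integrable
      ((Set.pi (roundIndices n ℓ : Set _) (roundBox ρ θ m s)).indicator (fun _ => f s))
      sampleMeasure := (integrable_const _).indicator (hbox m s)
  simp_rw [hf]
  rw [integral_finsetSum _ fun s _ => integrable_finsetSum _ fun m _ => hint m s]
  refine Finset.sum_congr rfl fun s _ => ?_
  rw [integral_finsetSum _ fun m _ => hint m s]
  simp only [integral_indicator_const _ (hbox _ s), measure_pi_roundBox hρ hθ, smul_eq_mul,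
    Fintype.sum_bool, jointProb]
  simp
  ring

/-! ### The drift in log-odds coordinates -/

lemma half_lt_of_criticalFidelity_lt {r ρ : ℝ} (hρ : ρ ∈ Ioo (criticalFidelity r) 1) :
    ρ ∈ Ioo (1 / 2 : ℝ) 1 := by
  refine ⟨?_, hρ.2⟩
  have h := hρ.1
  unfold criticalFidelity at h
  linarith [Real.sqrt_nonneg ((2 - r) / r)]

lemma driftStat_mem {r ρ : ℝ} (hr : r ∈ Ioo (1 : ℝ) 2) (hρ : ρ ∈ Ioo (criticalFidelity r) 1) :
    driftStat r ρ ∈ Ioo (0 : ℝ) 1 := by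
  obtain ⟨h1, h2⟩ := half_lt_of_criticalFidelity_lt hρ
  obtain ⟨r1, r2⟩ := hr
  have hk : 0 < (2 * ρ - 1) ^ 2 := by have : 0 < 2 * ρ - 1 := by linarith
                                      positivity
  have hden : 0 < (r - 1) * (2 * ρ - 1) ^ 2 := mul_pos (by linarith) hk
  have hcrit : (2 - r) / r < (2 * ρ - 1) ^ 2 := by
    have h := hρ.1
    unfold criticalFidelity at h
    rw [← Real.sqrt_lt' (by linarith)]
    linarith
  rw [div_lt_iff₀ (by linarith)] at hcrit
  unfold driftStat
  refine ⟨div_pos ?_ hden, ?_⟩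
  · have : 0 < 2 - r := by linarith
    have : 0 < 1 - ρ := by linarith
    have : 0 < ρ := by linarith
    positivity
  · rw [div_lt_one hden]
    nlinarith

lemma sqrt_one_sub_driftStat_mem {r ρ : ℝ} (hr : r ∈ Ioo (1 : ℝ) 2)
    (hρ : ρ ∈ Ioo (criticalFidelity r) 1) : √(1 - driftStat r ρ) ∈ Ioo (0 : ℝ) 1 := by
  obtain ⟨h1, h2⟩ := driftStat_mem hr hρ
  exact ⟨Real.sqrt_pos.2 (by linarith), (Real.sqrt_lt' one_pos).2 (by linarith)⟩

lemma thetaMinus_mem {r ρ : ℝ} (hr : r ∈ Ioo (1 : ℝ) 2) (hρ : ρ ∈ Ioo (criticalFidelity r) 1) :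
    thetaMinus r ρ ∈ Ioo (0 : ℝ) 1 := by
  obtain ⟨h1, h2⟩ := sqrt_one_sub_driftStat_mem hr hρ
  unfold thetaMinus
  constructor <;> linarith

lemma thetaPlus_mem {r ρ : ℝ} (hr : r ∈ Ioo (1 : ℝ) 2) (hρ : ρ ∈ Ioo (criticalFidelity r) 1) :
    thetaPlus r ρ ∈ Ioo (0 : ℝ) 1 := by
  obtain ⟨h1, h2⟩ := sqrt_one_sub_driftStat_mem hr hρ
  unfold thetaPlus
  constructor <;> linarith

lemma thetaMinus_lt_thetaPlus {r ρ : ℝ} (hr : r ∈ Ioo (1 : ℝ) 2)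
    (hρ : ρ ∈ Ioo (criticalFidelity r) 1) : thetaMinus r ρ < thetaPlus r ρ := by
  obtain ⟨h1, h2⟩ := sqrt_one_sub_driftStat_mem hr hρ
  unfold thetaPlus thetaMinus
  linarith

lemma sigmoid_mem (z : ℝ) : Real.sigmoid z ∈ Ioo (0 : ℝ) 1 :=
  ⟨Real.sigmoid_pos z, Real.sigmoid_lt_one z⟩

lemma sigmoid_logOdds {θ : ℝ} (hθ : θ ∈ Ioo (0 : ℝ) 1) : Real.sigmoid (logOdds θ) = θ := by
  obtain ⟨h0, h1⟩ := hθ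
  have h2 : 0 < 1 - θ := by linarith
  rw [Real.sigmoid_def, logOdds, Real.exp_neg, Real.exp_log (div_pos h0 h2)]
  field_simp
  ring

/-- The drift of the log-odds recursion. -/
noncomputable def drift (r ρ z : ℝ) : ℝ := payoffDiff r ρ (Real.sigmoid z)

/-- The product `p_H p_L` of the two marginal probabilities, as a function of the log-odds. -/
noncomputable def marginalProd (ρ z : ℝ) : ℝ :=
  ρ * (1 - ρ) + (2 * ρ - 1) ^ 2 * (Real.sigmoid z * (1 - Real.sigmoid z))

lemma marginalProd_mem {ρ : ℝ} (hρ : ρ ∈ Ioo (1 / 2 : ℝ) 1) (z : ℝ) :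
    marginalProd ρ z ∈ Ioc (0 : ℝ) 1 := by
  obtain ⟨h0, h1⟩ := sigmoid_mem z
  obtain ⟨h2, h3⟩ := hρ
  unfold marginalProd
  have hs : 0 < Real.sigmoid z * (1 - Real.sigmoid z) := mul_pos h0 (by linarith)
  have hs' : Real.sigmoid z * (1 - Real.sigmoid z) ≤ 1 / 4 := by
    nlinarith [sq_nonneg (Real.sigmoid z - 1 / 2)]
  have hq : 0 < ρ * (1 - ρ) := mul_pos (by linarith) (by linarith)
  constructor
  · positivity
  · nlinarith [sq_nonneg (2 * ρ - 1)]

lemma drift_eq {r ρ : ℝ} (hρ : ρ ∈ Ioo (1 / 2 : ℝ) 1) (z : ℝ) :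
    drift r ρ z = 2 * r - 2 - r * (ρ * (1 - ρ)) / marginalProd ρ z :=
  payoffDiff_eq hρ (sigmoid_mem z)

lemma drift_eq_factored {r ρ : ℝ} (hr : r ∈ Ioo (1 : ℝ) 2)
    (hρ : ρ ∈ Ioo (criticalFidelity r) 1) (z : ℝ) :
    drift r ρ z = (2 * r - 2) * (2 * ρ - 1) ^ 2 *
      ((Real.sigmoid z - thetaMinus r ρ) * (thetaPlus r ρ - Real.sigmoid z)) /
        marginalProd ρ z := by
  have hρ' := half_lt_of_criticalFidelity_lt hρ
  have hm := (marginalProd_mem hρ' z).1.ne'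
  have hk : (2 * ρ - 1) ≠ 0 := by linarith [hρ'.1]
  have hr1 : r - 1 ≠ 0 := by linarith [hr.1]
  have hfac : (Real.sigmoid z - thetaMinus r ρ) * (thetaPlus r ρ - Real.sigmoid z) =
      Real.sigmoid z * (1 - Real.sigmoid z) - driftStat r ρ / 4 := by
    have hsq := Real.sq_sqrt (show 0 ≤ 1 - driftStat r ρ by linarith [(driftStat_mem hr hρ).2])
    unfold thetaMinus thetaPlus
    linear_combination (1 / 4) * hsq
  rw [drift_eq hρ', hfac, eq_div_iff hm, sub_mul, div_mul_cancel₀ _ hm]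
  unfold marginalProd driftStat
  field_simp
  ring

lemma driftCoeff_pos {r ρ : ℝ} (hr : r ∈ Ioo (1 : ℝ) 2) (hρ : ρ ∈ Ioo (criticalFidelity r) 1) :
    0 < (2 * r - 2) * (2 * ρ - 1) ^ 2 := by
  have h1 : 0 < 2 * r - 2 := by linarith [hr.1]
  have h2 : 0 < 2 * ρ - 1 := by linarith [(half_lt_of_criticalFidelity_lt hρ).1]
  positivity

lemma drift_nonneg {r ρ : ℝ} (hr : r ∈ Ioo (1 : ℝ) 2) (hρ : ρ ∈ Ioo (criticalFidelity r) 1)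
    {z : ℝ} (h1 : logOdds (thetaMinus r ρ) ≤ z) (h2 : z ≤ logOdds (thetaPlus r ρ)) :
    0 ≤ drift r ρ z := by
  have hm := (marginalProd_mem (half_lt_of_criticalFidelity_lt hρ) z).1
  have hk := driftCoeff_pos hr hρ
  rw [← Real.sigmoid_le_iff, sigmoid_logOdds (thetaMinus_mem hr hρ)] at h1
  rw [← Real.sigmoid_le_iff, sigmoid_logOdds (thetaPlus_mem hr hρ)] at h2
  rw [drift_eq_factored hr hρ]
  have := mul_nonneg (sub_nonneg.2 h1) (sub_nonneg.2 h2)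
  positivity

lemma drift_nonpos_of_le {r ρ : ℝ} (hr : r ∈ Ioo (1 : ℝ) 2)
    (hρ : ρ ∈ Ioo (criticalFidelity r) 1) {z : ℝ} (h1 : z ≤ logOdds (thetaMinus r ρ)) :
    drift r ρ z ≤ 0 := by
  have hm := (marginalProd_mem (half_lt_of_criticalFidelity_lt hρ) z).1
  have hk := driftCoeff_pos hr hρ
  have hlt := thetaMinus_lt_thetaPlus hr hρ
  rw [← Real.sigmoid_le_iff, sigmoid_logOdds (thetaMinus_mem hr hρ)] at h1
  rw [drift_eq_factored hr hρ]
  refine div_nonpos_of_nonpos_of_nonneg (mul_nonpos_of_nonneg_of_nonpos hk.le ?_) hm.le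
  exact mul_nonpos_of_nonpos_of_nonneg (by linarith) (by linarith)

lemma exists_pos_le_drift {r ρ : ℝ} (hr : r ∈ Ioo (1 : ℝ) 2)
    (hρ : ρ ∈ Ioo (criticalFidelity r) 1) {a b : ℝ} (ha : logOdds (thetaMinus r ρ) < a)
    (hb : b < logOdds (thetaPlus r ρ)) :
    ∃ c > 0, ∀ z ∈ Icc a b, c ≤ drift r ρ z := by
  have hk := driftCoeff_pos hr hρ
  rw [← Real.sigmoid_lt_iff, sigmoid_logOdds (thetaMinus_mem hr hρ)] at ha
  rw [← Real.sigmoid_lt_iff, sigmoid_logOdds (thetaPlus_mem hr hρ)] at hb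
  refine ⟨_, mul_pos hk (mul_pos (sub_pos.2 ha) (sub_pos.2 hb)), fun z hz => ?_⟩
  have hm := marginalProd_mem (half_lt_of_criticalFidelity_lt hρ) z
  have h1 := Real.sigmoid_le hz.1
  have h2 := Real.sigmoid_le hz.2
  rw [drift_eq_factored hr hρ, le_div_iff₀ hm.1]
  refine (mul_le_of_le_one_right (mul_pos hk (mul_pos (sub_pos.2 ha) (sub_pos.2 hb))).le
    hm.2).trans ?_
  gcongr
  · linarith

lemma exists_drift_le_neg {r ρ : ℝ} (hr : r ∈ Ioo (1 : ℝ) 2)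
    (hρ : ρ ∈ Ioo (criticalFidelity r) 1) {b : ℝ} (hb : logOdds (thetaPlus r ρ) < b) :
    ∃ c > 0, ∀ z, b ≤ z → drift r ρ z ≤ -c := by
  have hk := driftCoeff_pos hr hρ
  have hlt := thetaMinus_lt_thetaPlus hr hρ
  rw [← Real.sigmoid_lt_iff, sigmoid_logOdds (thetaPlus_mem hr hρ)] at hb
  have hpos : 0 < (Real.sigmoid b - thetaMinus r ρ) * (Real.sigmoid b - thetaPlus r ρ) :=
    mul_pos (by linarith) (by linarith)
  refine ⟨_, mul_pos hk hpos, fun z hz => ?_⟩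
  have hm := marginalProd_mem (half_lt_of_criticalFidelity_lt hρ) z
  have h1 := Real.sigmoid_le hz
  rw [drift_eq_factored hr hρ, div_le_iff₀ hm.1, neg_mul, le_neg, ← mul_neg]
  refine (mul_le_of_le_one_right (mul_pos hk hpos).le hm.2).trans ?_
  rw [← mul_neg, neg_sub]
  gcongr
  linarith

lemma hasDerivAt_drift {r ρ : ℝ} (hρ : ρ ∈ Ioo (1 / 2 : ℝ) 1) (z : ℝ) :
    HasDerivAt (drift r ρ) (r * (ρ * (1 - ρ)) * ((2 * ρ - 1) ^ 2 *
      (Real.sigmoid z * (1 - Real.sigmoid z) * (1 - 2 * Real.sigmoid z))) /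
        marginalProd ρ z ^ 2) z := by
  have hs := Real.hasDerivAt_sigmoid z
  have hm := (marginalProd_mem hρ z).1.ne'
  have h1 : HasDerivAt (marginalProd ρ) ((2 * ρ - 1) ^ 2 *
      (Real.sigmoid z * (1 - Real.sigmoid z) * (1 - 2 * Real.sigmoid z))) z := by
    exact (((hs.mul (hs.const_sub 1)).const_mul ((2 * ρ - 1) ^ 2)).const_add
      (ρ * (1 - ρ))).congr_deriv (by ring)
  have h2 := ((h1.inv hm).const_mul (r * (ρ * (1 - ρ)))).const_sub (2 * r - 2)
  rw [show drift r ρ = fun z => 2 * r - 2 - r * (ρ * (1 - ρ)) * (marginalProd ρ z)⁻¹ from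
    funext fun z => by rw [drift_eq hρ, div_eq_mul_inv]]
  exact h2.congr_deriv (by ring)

lemma abs_drift_sub_le {r ρ : ℝ} (hr : r ∈ Ioo (1 : ℝ) 2) (hρ : ρ ∈ Ioo (1 / 2 : ℝ) 1)
    (x y : ℝ) : |drift r ρ x - drift r ρ y| ≤ |x - y| := by
  have h := Convex.norm_image_sub_le_of_norm_hasDerivWithin_le (C := 1) (s := univ)
    (fun z _ => (hasDerivAt_drift (r := r) hρ z).hasDerivWithinAt) (fun z _ => ?_) convex_univ
    (mem_univ y) (mem_univ x)
  · simpa using h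
  · have hm := (marginalProd_mem hρ z).1
    obtain ⟨h0, h1⟩ := sigmoid_mem z
    have hq : 0 < ρ * (1 - ρ) := mul_pos (by linarith [hρ.1]) (by linarith [hρ.2])
    have hK : 0 ≤ (2 * ρ - 1) ^ 2 * (Real.sigmoid z * (1 - Real.sigmoid z)) :=
      mul_nonneg (sq_nonneg _) (mul_pos h0 (by linarith)).le
    rw [Real.norm_eq_abs, abs_div, abs_of_pos (pow_pos hm 2), div_le_one (pow_pos hm 2)]
    have e : r * (ρ * (1 - ρ)) * ((2 * ρ - 1) ^ 2 *
        (Real.sigmoid z * (1 - Real.sigmoid z) * (1 - 2 * Real.sigmoid z))) =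
        r * (ρ * (1 - ρ)) * ((2 * ρ - 1) ^ 2 * (Real.sigmoid z * (1 - Real.sigmoid z))) *
          (1 - 2 * Real.sigmoid z) := by ring
    unfold marginalProd at hm ⊢
    set q := ρ * (1 - ρ)
    set u := (2 * ρ - 1) ^ 2 * (Real.sigmoid z * (1 - Real.sigmoid z))
    rw [e, abs_mul, abs_of_nonneg (mul_nonneg (mul_nonneg (by linarith [hr.1]) hq.le) hK)]
    have h3 : |1 - 2 * Real.sigmoid z| ≤ 1 := abs_le.2 ⟨by linarith, by linarith⟩
    have hqu : 0 ≤ q * u := mul_nonneg hq.le hK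
    have hr0 : 0 ≤ r * q * u := by
      have : 0 ≤ r := by linarith [hr.1]
      rw [mul_assoc]; positivity
    refine (mul_le_of_le_one_right hr0 h3).trans ?_
    nlinarith [sq_nonneg (q - u), hr.2]

lemma drift_sub_le {r ρ : ℝ} (hr : r ∈ Ioo (1 : ℝ) 2) (hρ : ρ ∈ Ioo (1 / 2 : ℝ) 1)
    {x y : ℝ} (h : x ≤ y) : drift r ρ x - drift r ρ y ≤ y - x := by
  have := (le_abs_self _).trans (abs_drift_sub_le hr hρ x y)
  rwa [abs_sub_comm, abs_of_nonneg (sub_nonneg.2 h)] at this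

lemma continuous_drift {r ρ : ℝ} (hρ : ρ ∈ Ioo (1 / 2 : ℝ) 1) : Continuous (drift r ρ) :=
  continuous_iff_continuousAt.2 fun z => (hasDerivAt_drift hρ z).continuousAt

lemma abs_sigmoid_sub_le (x y : ℝ) : |Real.sigmoid x - Real.sigmoid y| ≤ |x - y| := by
  have h := Convex.norm_image_sub_le_of_norm_hasDerivWithin_le (C := 1) (s := univ)
    (fun z _ => (Real.hasDerivAt_sigmoid z).hasDerivWithinAt) (fun z _ => ?_) convex_univ
    (mem_univ y) (mem_univ x)
  · simpa using h
  · obtain ⟨h0, h1⟩ := sigmoid_mem z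
    rw [Real.norm_eq_abs, abs_le]
    constructor <;> nlinarith

/-! ### Measurability -/

lemma measurable_actions (ρ : ℝ) {Θ : Sample → ℝ} (hΘ : Measurable Θ) (n ℓ : ℕ) :
    Measurable fun ω => actions ρ (Θ ω) ω n ℓ := by
  have hm : Measurable fun ω => mode (Θ ω) ω n ℓ :=
    Measurable.ite (measurableSet_lt (by fun_prop) hΘ) measurable_const measurable_const
  exact measurable_pi_lambda _ fun i =>
    Measurable.ite (measurableSet_lt (by fun_prop) measurable_const) hm
      ((measurable_of_finite Bool.not).comp hm)

lemma measurable_profileEstimate (r ρ : ℝ) {Θ : Sample → ℝ} (hΘ : Measurable Θ) (n ℓ : ℕ) :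
    Measurable fun ω => profileEstimate r ρ (Θ ω) (actions ρ (Θ ω) ω n ℓ) := by
  have ha := measurable_actions ρ hΘ n ℓ
  have hf (f : (Fin 2 → Action) → ℝ) : Measurable fun ω => f (actions ρ (Θ ω) ω n ℓ) :=
    (measurable_of_finite f).comp ha
  unfold profileEstimate ipw
  refine (Finset.measurable_fun_sum _ fun i _ => ?_).const_mul _
  have hH : Measurable fun ω => probH ρ (Θ ω) := by unfold probH; fun_prop
  have hL : Measurable fun ω => probL ρ (Θ ω) := by unfold probL; fun_prop
  exact (((hf fun s => profit r s i).div hH).mul (hf fun s => if s i = true then 1 else 0)).sub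
    (((hf fun s => profit r s i).div hL).mul (hf fun s => if s i = false then 1 else 0))

lemma measurable_batchAverage (r ρ : ℝ) (b : ℕ) {Θ : Sample → ℝ} (hΘ : Measurable Θ) (n : ℕ) :
    Measurable fun ω => batchAverage r ρ b (Θ ω) ω n := by
  simp only [batchAverage_eq]
  exact (Finset.measurable_fun_sum _ fun ℓ _ => measurable_profileEstimate r ρ hΘ n ℓ).const_mul _

lemma measurable_logOddsPath (r ρ α η : ℝ) (b : ℕ) (θ₀ : ℝ) (n : ℕ) :
    Measurable fun ω => logOddsPath r ρ α η b θ₀ ω n := by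
  induction n with
  | zero => exact measurable_const
  | succ n ih =>
    exact ih.add ((measurable_batchAverage r ρ b
      (continuous_sigmoid.measurable.comp ih) n).const_mul _)

/-! ### The moment generating function of the batch noise -/

lemma lintegral_exp_round_le {r ρ θ : ℝ} (hr : r ∈ Ioo (1 : ℝ) 2) (hρ : ρ ∈ Ioo (1 / 2 : ℝ) 1)
    (hθ : θ ∈ Ioo (0 : ℝ) 1) (n ℓ : ℕ) (t : ℝ) :
    ∫⁻ ω, ENNReal.ofReal (Real.exp (t * (profileEstimate r ρ θ (actions ρ θ ω n ℓ) -
      payoffDiff r ρ θ))) ∂sampleMeasure ≤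
      ENNReal.ofReal (Real.exp ((4 / (1 - ρ)) ^ 2 * t ^ 2 / 2)) := by
  have hB : 0 ≤ 4 / (1 - ρ) := div_nonneg (by norm_num) (by linarith [hρ.2])
  have hsub := ProbabilityTheory.hasSubgaussianMGF_of_mem_Icc (μ := sampleMeasure)
    (X := fun ω => profileEstimate r ρ θ (actions ρ θ ω n ℓ))
    (a := -(4 / (1 - ρ))) (b := 4 / (1 - ρ))
    (measurable_profileEstimate r ρ measurable_const n ℓ).aemeasurable
    (ae_of_all _ fun ω => abs_le.1 (abs_profileEstimate_le hr hρ hθ _))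
  have hmean : ∫ ω, profileEstimate r ρ θ (actions ρ θ ω n ℓ) ∂sampleMeasure = payoffDiff r ρ θ := by
    rw [integral_comp_actions ⟨by linarith [hρ.1], hρ.2.le⟩ ⟨hθ.1.le, hθ.2.le⟩,
      sum_jointProb_mul_profileEstimate hρ hθ]
  rw [hmean] at hsub
  rw [← ofReal_integral_eq_lintegral_ofReal (hsub.integrable_exp_mul t)
    (ae_of_all _ fun ω => (Real.exp_pos _).le)]
  refine ENNReal.ofReal_le_ofReal ((hsub.mgf_le t).trans (le_of_eq ?_))
  congr 3
  simp only [NNReal.coe_pow, NNReal.coe_div, coe_nnnorm, NNReal.coe_ofNat]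
  rw [sub_neg_eq_add, Real.norm_of_nonneg (by positivity)]
  ring

lemma actions_congr (ρ θ : ℝ) {ω ω' : Sample} {n ℓ : ℕ} (h : ∀ o, ω (n, ℓ, o) = ω' (n, ℓ, o)) :
    actions ρ θ ω n ℓ = actions ρ θ ω' n ℓ := by
  unfold actions mode
  simp only [h]

lemma batchAverage_congr (r ρ : ℝ) (b : ℕ) (θ : ℝ) {ω ω' : Sample} {n : ℕ}
    (h : ∀ ℓ o, ω (n, ℓ, o) = ω' (n, ℓ, o)) :
    batchAverage r ρ b θ ω n = batchAverage r ρ b θ ω' n := by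
  simp only [batchAverage_eq, actions_congr ρ θ (h _)]

lemma lintegral_exp_sum_round_le {r ρ θ : ℝ} (hr : r ∈ Ioo (1 : ℝ) 2)
    (hρ : ρ ∈ Ioo (1 / 2 : ℝ) 1) (hθ : θ ∈ Ioo (0 : ℝ) 1) (n m : ℕ) (t : ℝ) :
    ∫⁻ ω, ENNReal.ofReal (Real.exp (t * ∑ ℓ ∈ Finset.range m,
      (profileEstimate r ρ θ (actions ρ θ ω n ℓ) - payoffDiff r ρ θ))) ∂sampleMeasure ≤
      ENNReal.ofReal (Real.exp (m * ((4 / (1 - ρ)) ^ 2 * t ^ 2 / 2))) := by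
  induction m with
  | zero => simp
  | succ m ih =>
    have hmeas (ℓ : ℕ) : Measurable fun ω => profileEstimate r ρ θ (actions ρ θ ω n ℓ) :=
      measurable_profileEstimate r ρ measurable_const n ℓ
    rw [lintegral_splice (fun i => i.2.1 < m) (by fun_prop)]
    have hle (ω : Sample) : ∫⁻ ω', ENNReal.ofReal (Real.exp (t * ∑ ℓ ∈ Finset.range (m + 1),
        (profileEstimate r ρ θ (actions ρ θ (splice (fun i => i.2.1 < m) (ω, ω')) n ℓ) -
          payoffDiff r ρ θ))) ∂sampleMeasure ≤
        ENNReal.ofReal (Real.exp (t * ∑ ℓ ∈ Finset.range m,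
          (profileEstimate r ρ θ (actions ρ θ ω n ℓ) - payoffDiff r ρ θ))) *
        ENNReal.ofReal (Real.exp ((4 / (1 - ρ)) ^ 2 * t ^ 2 / 2)) := by
      have hsplit (ω' : Sample) : t * ∑ ℓ ∈ Finset.range (m + 1),
          (profileEstimate r ρ θ (actions ρ θ (splice (fun i => i.2.1 < m) (ω, ω')) n ℓ) -
            payoffDiff r ρ θ) = t * ∑ ℓ ∈ Finset.range m,
          (profileEstimate r ρ θ (actions ρ θ ω n ℓ) - payoffDiff r ρ θ) +
          t * (profileEstimate r ρ θ (actions ρ θ ω' n m) - payoffDiff r ρ θ) := by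
        rw [Finset.sum_range_succ, mul_add]
        congr 2
        · refine Finset.sum_congr rfl fun ℓ hℓ => ?_
          rw [actions_congr (ω' := ω)]
          simp [splice, Finset.mem_range.1 hℓ]
        · rw [actions_congr (ω' := ω')]
          simp [splice]
      simp only [hsplit, Real.exp_add, ENNReal.ofReal_mul (Real.exp_pos _).le]
      rw [lintegral_const_mul _ (by fun_prop)]
      gcongr
      exact lintegral_exp_round_le hr hρ hθ n m t
    refine (lintegral_mono hle).trans ?_
    rw [lintegral_mul_const _ (by fun_prop)]
    refine (mul_le_mul_left ih _).trans (le_of_eq ?_)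
    rw [← ENNReal.ofReal_mul (Real.exp_pos _).le, ← Real.exp_add]
    push_cast
    ring_nf

lemma lintegral_exp_batch_le {r ρ θ : ℝ} (hr : r ∈ Ioo (1 : ℝ) 2) (hρ : ρ ∈ Ioo (1 / 2 : ℝ) 1)
    (hθ : θ ∈ Ioo (0 : ℝ) 1) {b : ℕ} (hb : 1 ≤ b) (n : ℕ) (t : ℝ) :
    ∫⁻ ω, ENNReal.ofReal (Real.exp (t * (batchAverage r ρ b θ ω n - payoffDiff r ρ θ)))
      ∂sampleMeasure ≤ ENNReal.ofReal (Real.exp ((4 / (1 - ρ)) ^ 2 * t ^ 2 / (2 * b))) := by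
  have hb0 : (b : ℝ) ≠ 0 := by positivity
  have h := lintegral_exp_sum_round_le hr hρ hθ n b (t / b)
  have e (ω : Sample) : t / b * ∑ ℓ ∈ Finset.range b,
      (profileEstimate r ρ θ (actions ρ θ ω n ℓ) - payoffDiff r ρ θ) =
      t * (batchAverage r ρ b θ ω n - payoffDiff r ρ θ) := by
    rw [batchAverage_eq, Finset.sum_sub_distrib, Finset.sum_const, Finset.card_range,
      nsmul_eq_mul]
    field_simp
  simp only [e] at h
  refine h.trans (le_of_eq ?_)
  congr 2
  field_simp

/-! ### The noise of the recursion and its maximal inequality -/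

/-- The noise of the recursion at step `n`. -/
noncomputable def noise (r ρ α η : ℝ) (b : ℕ) (θ₀ : ℝ) (ω : Sample) (n : ℕ) : ℝ :=
  batchAverage r ρ b (Real.sigmoid (logOddsPath r ρ α η b θ₀ ω n)) ω n -
    drift r ρ (logOddsPath r ρ α η b θ₀ ω n)

lemma logOddsPath_succ (r ρ α η : ℝ) (b : ℕ) (θ₀ : ℝ) (ω : Sample) (n : ℕ) :
    logOddsPath r ρ α η b θ₀ ω (n + 1) = logOddsPath r ρ α η b θ₀ ω n +
      stepSize α η n * (drift r ρ (logOddsPath r ρ α η b θ₀ ω n) +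
        noise r ρ α η b θ₀ ω n) := by
  simp [logOddsPath, noise]

lemma measurable_noise {r ρ : ℝ} (hρ : ρ ∈ Ioo (1 / 2 : ℝ) 1) (α η : ℝ) (b : ℕ) (θ₀ : ℝ) (n : ℕ) :
    Measurable fun ω => noise r ρ α η b θ₀ ω n :=
  have h := measurable_logOddsPath r ρ α η b θ₀ n
  (measurable_batchAverage r ρ b (continuous_sigmoid.measurable.comp h) n).sub
    ((continuous_drift hρ).measurable.comp h)

/-- The weighted noise sum, stopped when it first reaches the level `x`. -/
noncomputable def stoppedSum (c ξ : ℕ → ℝ) (x : ℝ) : ℕ → ℝ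
  | 0 => 0
  | n + 1 => stoppedSum c ξ x n + (if stoppedSum c ξ x n < x then c n else 0) * ξ n

lemma le_stoppedSum_or_eq (c ξ : ℕ → ℝ) (x : ℝ) (n : ℕ) :
    x ≤ stoppedSum c ξ x n ∨ stoppedSum c ξ x n = ∑ k ∈ Finset.range n, c k * ξ k := by
  induction n with
  | zero => right; simp [stoppedSum]
  | succ n ih =>
    by_cases h : stoppedSum c ξ x n < x
    · right
      rw [stoppedSum, if_pos h, Finset.sum_range_succ, ih.resolve_left (not_le.2 h)]
    · left
      rw [stoppedSum, if_neg h]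
      linarith

lemma le_stoppedSum_of_le {c ξ : ℕ → ℝ} {x : ℝ} {m n : ℕ} (hmn : m ≤ n)
    (h : x ≤ stoppedSum c ξ x m) : x ≤ stoppedSum c ξ x n := by
  induction n, hmn using Nat.le_induction with
  | base => exact h
  | succ n _ ih => rw [stoppedSum, if_neg (not_lt.2 ih)]; simpa using ih

lemma le_stoppedSum_of_le_sum {c ξ : ℕ → ℝ} {x : ℝ} {n : ℕ}
    (h : x ≤ ∑ k ∈ Finset.range n, c k * ξ k) : x ≤ stoppedSum c ξ x n :=
  (le_stoppedSum_or_eq c ξ x n).elim id fun e => e ▸ h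

lemma stoppedSum_congr {c ξ ξ' : ℕ → ℝ} {x : ℝ} {n : ℕ} (h : ∀ k < n, ξ k = ξ' k) :
    stoppedSum c ξ x n = stoppedSum c ξ' x n := by
  induction n with
  | zero => rfl
  | succ n ih => rw [stoppedSum, stoppedSum, ih fun k hk => h k (by omega), h n (by omega)]

lemma logOddsPath_congr (r ρ α η : ℝ) (b : ℕ) (θ₀ : ℝ) {ω ω' : Sample} {n : ℕ}
    (h : ∀ k < n, ∀ ℓ o, ω (k, ℓ, o) = ω' (k, ℓ, o)) :
    logOddsPath r ρ α η b θ₀ ω n = logOddsPath r ρ α η b θ₀ ω' n := by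
  induction n with
  | zero => rfl
  | succ n ih =>
    rw [logOddsPath, logOddsPath, ih fun k hk => h k (by omega),
      batchAverage_congr r ρ b _ (h n (by omega))]

lemma noise_congr (r ρ α η : ℝ) (b : ℕ) (θ₀ : ℝ) {ω ω' : Sample} {n : ℕ}
    (h : ∀ k ≤ n, ∀ ℓ o, ω (k, ℓ, o) = ω' (k, ℓ, o)) :
    noise r ρ α η b θ₀ ω n = noise r ρ α η b θ₀ ω' n := by
  rw [noise, noise, logOddsPath_congr r ρ α η b θ₀ fun k hk => h k hk.le,
    batchAverage_congr r ρ b _ (h n le_rfl)]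

lemma measurable_stoppedSum {ξ : Sample → ℕ → ℝ} (hξ : ∀ n, Measurable fun ω => ξ ω n)
    (c : ℕ → ℝ) (x : ℝ) (n : ℕ) : Measurable fun ω => stoppedSum c (ξ ω) x n := by
  induction n with
  | zero => exact measurable_const
  | succ n ih =>
    exact ih.add ((Measurable.ite (measurableSet_lt ih measurable_const) measurable_const
      measurable_const).mul (hξ n))

lemma lintegral_exp_stoppedSum_le {r ρ : ℝ} (hr : r ∈ Ioo (1 : ℝ) 2)
    (hρ : ρ ∈ Ioo (1 / 2 : ℝ) 1) (α η : ℝ) {b : ℕ} (hb : 1 ≤ b) (θ₀ : ℝ) (c : ℕ → ℝ) (x t : ℝ)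
    (n : ℕ) :
    ∫⁻ ω, ENNReal.ofReal (Real.exp (t * stoppedSum c (noise r ρ α η b θ₀ ω) x n))
      ∂sampleMeasure ≤ ENNReal.ofReal (Real.exp
        ((4 / (1 - ρ)) ^ 2 * t ^ 2 / (2 * b) * ∑ k ∈ Finset.range n, c k ^ 2)) := by
  have hmeas (n : ℕ) : Measurable fun ω => stoppedSum c (noise r ρ α η b θ₀ ω) x n :=
    measurable_stoppedSum (measurable_noise hρ α η b θ₀) c x n
  induction n with
  | zero => simp [stoppedSum]
  | succ n ih =>
    have := hmeas n
    have := hmeas (n + 1)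
    rw [lintegral_splice (fun i => i.1 < n) (by fun_prop)]
    have hle (ω : Sample) : ∫⁻ ω', ENNReal.ofReal (Real.exp (t * stoppedSum c
        (noise r ρ α η b θ₀ (splice (fun i => i.1 < n) (ω, ω'))) x (n + 1))) ∂sampleMeasure ≤
        ENNReal.ofReal (Real.exp (t * stoppedSum c (noise r ρ α η b θ₀ ω) x n)) *
        ENNReal.ofReal (Real.exp ((4 / (1 - ρ)) ^ 2 * t ^ 2 / (2 * b) * c n ^ 2)) := by
      set A := if stoppedSum c (noise r ρ α η b θ₀ ω) x n < x then c n else 0 with hA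
      set θ := Real.sigmoid (logOddsPath r ρ α η b θ₀ ω n) with hθ
      have hsplit (ω' : Sample) : t * stoppedSum c
          (noise r ρ α η b θ₀ (splice (fun i => i.1 < n) (ω, ω'))) x (n + 1) =
          t * stoppedSum c (noise r ρ α η b θ₀ ω) x n +
            t * A * (batchAverage r ρ b θ ω' n - payoffDiff r ρ θ) := by
        have e1 : stoppedSum c (noise r ρ α η b θ₀ (splice (fun i => i.1 < n) (ω, ω'))) x n =
            stoppedSum c (noise r ρ α η b θ₀ ω) x n :=
          stoppedSum_congr fun k hk => noise_congr r ρ α η b θ₀ fun j hj ℓ o => by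
            simp [splice, show j < n by omega]
        have e2 : logOddsPath r ρ α η b θ₀ (splice (fun i => i.1 < n) (ω, ω')) n =
            logOddsPath r ρ α η b θ₀ ω n :=
          logOddsPath_congr r ρ α η b θ₀ fun k hk ℓ o => by simp [splice, hk]
        have e3 : batchAverage r ρ b θ (splice (fun i => i.1 < n) (ω, ω')) n =
            batchAverage r ρ b θ ω' n :=
          batchAverage_congr r ρ b θ fun ℓ o => by simp [splice]
        rw [stoppedSum, e1, noise, e2, ← hθ, e3, ← hA, drift, ← hθ]
        ring
      have := measurable_batchAverage r ρ b (Θ := fun _ => θ) measurable_const n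
      simp only [hsplit, Real.exp_add, ENNReal.ofReal_mul (Real.exp_pos _).le]
      rw [lintegral_const_mul _ (by fun_prop)]
      gcongr
      refine (lintegral_exp_batch_le hr hρ (sigmoid_mem _) hb n (t * A)).trans ?_
      refine ENNReal.ofReal_le_ofReal (Real.exp_le_exp.2 ?_)
      have hA2 : A ^ 2 ≤ c n ^ 2 := by
        rw [hA]; split_ifs
        · exact le_rfl
        · simpa using sq_nonneg (c n)
      rw [mul_pow, ← mul_assoc, mul_div_right_comm]
      gcongr
    refine (lintegral_mono hle).trans ?_
    rw [lintegral_mul_const _ (by fun_prop)]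
    refine (mul_le_mul_left ih _).trans (le_of_eq ?_)
    rw [← ENNReal.ofReal_mul (Real.exp_pos _).le, ← Real.exp_add, Finset.sum_range_succ, mul_add]

lemma measure_exists_le_sum_noise_le {r ρ : ℝ} (hr : r ∈ Ioo (1 : ℝ) 2)
    (hρ : ρ ∈ Ioo (1 / 2 : ℝ) 1) (α η : ℝ) {b : ℕ} (hb : 1 ≤ b) (θ₀ : ℝ) {c : ℕ → ℝ} {V : ℝ}
    (hV : 0 < V) (hc : ∀ n, ∑ k ∈ Finset.range n, c k ^ 2 ≤ V) {x : ℝ} (hx : 0 < x) :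
    sampleMeasure {ω | ∃ n, x ≤ ∑ k ∈ Finset.range n, c k * noise r ρ α η b θ₀ ω k} ≤
      ENNReal.ofReal (Real.exp (-(b * x ^ 2 / (2 * (4 / (1 - ρ)) ^ 2 * V)))) := by
  have h0 : 0 < 1 - ρ := by linarith [hρ.2]
  have hb0 : (0 : ℝ) < b := by positivity
  set t : ℝ := b * x / ((4 / (1 - ρ)) ^ 2 * V) with ht
  have ht0 : 0 < t := by positivity
  have hfix (n : ℕ) : sampleMeasure {ω | x ≤ stoppedSum c (noise r ρ α η b θ₀ ω) x n} ≤
      ENNReal.ofReal (Real.exp (-(b * x ^ 2 / (2 * (4 / (1 - ρ)) ^ 2 * V)))) := by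
    have hm := measurable_stoppedSum (measurable_noise (r := r) hρ α η b θ₀) c x n
    have hsub : {ω | x ≤ stoppedSum c (noise r ρ α η b θ₀ ω) x n} ⊆
        {ω | ENNReal.ofReal (Real.exp (t * x)) ≤
          ENNReal.ofReal (Real.exp (t * stoppedSum c (noise r ρ α η b θ₀ ω) x n))} :=
      fun ω hω => ENNReal.ofReal_le_ofReal
        (Real.exp_le_exp.2 (mul_le_mul_of_nonneg_left hω ht0.le))
    refine (measure_mono hsub).trans ((meas_ge_le_lintegral_div
      (Measurable.aemeasurable (by fun_prop))
      (ENNReal.ofReal_pos.2 (Real.exp_pos _)).ne' ENNReal.ofReal_ne_top).trans ?_)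
    rw [ENNReal.div_le_iff (ENNReal.ofReal_pos.2 (Real.exp_pos _)).ne' ENNReal.ofReal_ne_top,
      ← ENNReal.ofReal_mul (Real.exp_pos _).le, ← Real.exp_add]
    refine (lintegral_exp_stoppedSum_le hr hρ α η hb θ₀ c x t n).trans
      (ENNReal.ofReal_le_ofReal (Real.exp_le_exp.2 ?_))
    refine (mul_le_mul_of_nonneg_left (hc n) (by positivity)).trans (le_of_eq ?_)
    rw [ht]
    field_simp
    ring
  have hU : {ω | ∃ n, x ≤ ∑ k ∈ Finset.range n, c k * noise r ρ α η b θ₀ ω k} ⊆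
      ⋃ n, {ω | x ≤ stoppedSum c (noise r ρ α η b θ₀ ω) x n} := by
    rintro ω ⟨n, hn⟩
    exact mem_iUnion.2 ⟨n, le_stoppedSum_of_le_sum hn⟩
  refine (measure_mono hU).trans ?_
  have hmono : Monotone fun n => {ω | x ≤ stoppedSum c (noise r ρ α η b θ₀ ω) x n} :=
    fun m n hmn ω hω => le_stoppedSum_of_le hmn hω
  rw [hmono.measure_iUnion]
  exact iSup_le hfix

/-- A sub-Gaussian maximal inequality for weighted sums of the noise. -/
lemma measureReal_exists_le_abs_sum_noise_le {r ρ : ℝ} (hr : r ∈ Ioo (1 : ℝ) 2)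
    (hρ : ρ ∈ Ioo (1 / 2 : ℝ) 1) (α η : ℝ) {b : ℕ} (hb : 1 ≤ b) (θ₀ : ℝ) {c : ℕ → ℝ} {V : ℝ}
    (hV : 0 < V) (hc : ∀ n, ∑ k ∈ Finset.range n, c k ^ 2 ≤ V) {x : ℝ} (hx : 0 < x) :
    sampleMeasure.real {ω | ∃ n, x ≤ |∑ k ∈ Finset.range n, c k * noise r ρ α η b θ₀ ω k|} ≤
      2 * Real.exp (-(b * x ^ 2 / (2 * (4 / (1 - ρ)) ^ 2 * V))) := by
  have h1 := measure_exists_le_sum_noise_le hr hρ α η hb θ₀ hV hc hx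
  have h2 := measure_exists_le_sum_noise_le hr hρ α η hb θ₀ (c := fun k => -c k) hV
    (by simpa using hc) hx
  have hsub : {ω | ∃ n, x ≤ |∑ k ∈ Finset.range n, c k * noise r ρ α η b θ₀ ω k|} ⊆
      {ω | ∃ n, x ≤ ∑ k ∈ Finset.range n, c k * noise r ρ α η b θ₀ ω k} ∪
      {ω | ∃ n, x ≤ ∑ k ∈ Finset.range n, -c k * noise r ρ α η b θ₀ ω k} := by
    rintro ω ⟨n, hn⟩
    rcases le_abs.1 hn with h | h
    · exact Or.inl ⟨n, h⟩
    · exact Or.inr ⟨n, by simpa [Finset.sum_neg_distrib] using h⟩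
  refine (measureReal_mono hsub).trans ((measureReal_union_le _ _).trans ?_)
  rw [two_mul]
  exact add_le_add (ENNReal.toReal_le_of_le_ofReal (Real.exp_pos _).le h1)
    (ENNReal.toReal_le_of_le_ofReal (Real.exp_pos _).le h2)

/-! ### Step sizes -/

lemma stepSize_pos {η : ℝ} (hη : η ∈ Ioc (0 : ℝ) 1) (α : ℝ) (n : ℕ) : 0 < stepSize α η n :=
  div_pos hη.1 (Real.rpow_pos_of_pos (by positivity) _)

lemma stepSize_le_one {α η : ℝ} (hα : α ∈ Ioc (1 / 2 : ℝ) 1) (hη : η ∈ Ioc (0 : ℝ) 1) (n : ℕ) :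
    stepSize α η n ≤ 1 := by
  refine div_le_one_of_le₀ (hη.2.trans ?_) (by positivity)
  exact Real.one_le_rpow (by linarith [(Nat.cast_nonneg n : (0 : ℝ) ≤ n)]) (by linarith [hα.1])

lemma summable_stepSize_sq {α : ℝ} (hα : α ∈ Ioc (1 / 2 : ℝ) 1) (η : ℝ) :
    Summable fun n => stepSize α η n ^ 2 := by
  have h := (summable_nat_add_iff 1).2 (Real.summable_one_div_nat_rpow (p := α * 2).2
    (by linarith [hα.1]))
  refine (h.mul_left (η ^ 2)).congr fun n => ?_
  rw [stepSize, div_pow, Real.rpow_mul (by positivity), Real.rpow_two]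
  push_cast
  ring

lemma tendsto_stepTime {α η : ℝ} (hα : α ∈ Ioc (1 / 2 : ℝ) 1) (hη : η ∈ Ioc (0 : ℝ) 1) :
    Tendsto (stepTime (stepSize α η)) atTop atTop := by
  refine (not_summable_iff_tendsto_nat_atTop_of_nonneg fun n => (stepSize_pos hη α n).le).1 ?_
  intro h
  have h2 : Summable fun n : ℕ => 1 / ((n + 1 : ℕ) : ℝ) ^ α := by
    refine (h.mul_left η⁻¹).congr fun n => ?_
    have := hη.1.ne'
    rw [stepSize]
    push_cast
    field_simp
  have h3 := Real.summable_one_div_nat_rpow.1 ((summable_nat_add_iff 1).1 h2)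
  linarith [hα.2]

/-! ### Perturbed one-dimensional recursions -/

/-- If the drift is nonnegative near `a`, a recursion started above `a` whose accumulated noise stays
small remains above `a` up to that noise. -/
lemma le_sub_of_barrier {g : ℝ → ℝ} (hg : ∀ x y, x ≤ y → g x - g y ≤ y - x) {γ z ξ : ℕ → ℝ}
    (hγ0 : ∀ n, 0 ≤ γ n) (hγ1 : ∀ n, γ n ≤ 1) (hz : ∀ n, z (n + 1) = z n + γ n * (g (z n) + ξ n))
    {a e : ℝ} (ha : a ≤ z 0) (he : ∀ n, |∑ k ∈ Finset.range n, γ k * ξ k| ≤ e)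
    (hge : ∀ y ∈ Icc (a - e) (a + e), 0 ≤ g y) (n : ℕ) :
    a ≤ z n - ∑ k ∈ Finset.range n, γ k * ξ k := by
  induction n with
  | zero => simpa using ha
  | succ n ih =>
    rw [Finset.sum_range_succ, hz]
    have h1 := abs_le.1 (he n)
    set m := ∑ k ∈ Finset.range n, γ k * ξ k
    have h2 := hg (a + m) (z n) (by linarith)
    have h3 := hge (a + m) ⟨by linarith, by linarith⟩
    nlinarith [hγ0 n, hγ1 n, mul_nonneg (hγ0 n) (show 0 ≤ g (z n) + (z n - m - a) by linarith),
      mul_nonneg (sub_nonneg.2 (hγ1 n)) (sub_nonneg.2 ih)]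

lemma neg_drift_sub_le {g : ℝ → ℝ} (hg : ∀ x y, x ≤ y → g x - g y ≤ y - x) (x y : ℝ)
    (h : x ≤ y) : -g (-x) - -g (-y) ≤ y - x := by
  linarith [hg (-y) (-x) (by linarith)]

lemma sub_le_of_barrier {g : ℝ → ℝ} (hg : ∀ x y, x ≤ y → g x - g y ≤ y - x) {γ z ξ : ℕ → ℝ}
    (hγ0 : ∀ n, 0 ≤ γ n) (hγ1 : ∀ n, γ n ≤ 1) (hz : ∀ n, z (n + 1) = z n + γ n * (g (z n) + ξ n))
    {a e : ℝ} (ha : z 0 ≤ a) (he : ∀ n, |∑ k ∈ Finset.range n, γ k * ξ k| ≤ e)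
    (hge : ∀ y ∈ Icc (a - e) (a + e), g y ≤ 0) (n : ℕ) :
    z n - ∑ k ∈ Finset.range n, γ k * ξ k ≤ a := by
  have h := le_sub_of_barrier (g := fun x => -g (-x)) (neg_drift_sub_le hg) (z := fun n => -z n)
    (ξ := fun n => -ξ n) hγ0 hγ1 (fun n => by simp only [hz, neg_neg]; ring) (a := -a) (e := e)
    (by simpa using ha) (by simpa using he)
    (fun y hy => neg_nonneg.2 (hge (-y) ⟨by linarith [hy.2], by linarith [hy.1]⟩)) n
  simp only [mul_neg, Finset.sum_neg_distrib] at h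
  linarith

lemma eventually_le_of_absorbing {γ v : ℕ → ℝ} {b c : ℝ} {N : ℕ} (hc : 0 < c)
    (hγ : Tendsto (fun n => ∑ k ∈ Finset.range n, γ k) atTop atTop)
    (hup : ∀ n ≥ N, v n < b → v n + γ n * c ≤ v (n + 1))
    (habs : ∀ n ≥ N, b ≤ v n → b ≤ v (n + 1)) : ∀ᶠ n in atTop, b ≤ v n := by
  obtain ⟨n₀, hn₀, hb⟩ : ∃ n ≥ N, b ≤ v n := by
    by_contra! hcon
    have hsum (n : ℕ) (hn : N ≤ n) :
        v N + c * (∑ k ∈ Finset.range n, γ k - ∑ k ∈ Finset.range N, γ k) ≤ v n := by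
      induction n, hn using Nat.le_induction with
      | base => simp
      | succ n hn ih =>
        have := hup n hn (hcon n hn)
        rw [Finset.sum_range_succ]
        linarith
    obtain ⟨n, h1, h2⟩ := ((hγ.eventually_ge_atTop
      ((b - v N) / c + ∑ k ∈ Finset.range N, γ k)).and (eventually_ge_atTop N)).exists
    have h3 : b - v N ≤ c * (∑ k ∈ Finset.range n, γ k - ∑ k ∈ Finset.range N, γ k) := by
      rw [← div_le_iff₀' hc]; linarith
    linarith [hsum n h2, hcon n h2]
  filter_upwards [eventually_ge_atTop n₀] with n hn
  induction n, hn using Nat.le_induction with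
  | base => exact hb
  | succ n hn ih => exact habs n (hn₀.trans hn) ih

lemma eventually_le_of_drift {g : ℝ → ℝ} (hg : ∀ x y, x ≤ y → g x - g y ≤ y - x)
    {γ v m : ℕ → ℝ} (hγ0 : ∀ n, 0 ≤ γ n) (hγ1 : ∀ n, γ n ≤ 1)
    (hγ : Tendsto (fun n => ∑ k ∈ Finset.range n, γ k) atTop atTop) (hm : Tendsto m atTop (𝓝 0))
    (hv : ∀ n, v (n + 1) = v n + γ n * g (v n + m n)) {b c τ : ℝ} (hc : 0 < c) (hτ : 0 < τ)
    (h1 : ∀ n, v n + m n ≤ b + τ → c ≤ g (v n + m n))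
    (h2 : ∀ y ∈ Icc (b - τ) (b + τ), 0 ≤ g y) : ∀ᶠ n in atTop, b ≤ v n := by
  obtain ⟨N, hN⟩ := Metric.tendsto_atTop.1 hm τ hτ
  simp only [Real.dist_eq, sub_zero] at hN
  refine eventually_le_of_absorbing (N := N) hc hγ (fun n hn hlt => ?_) fun n hn hle => ?_
  · have := (abs_lt.1 (hN n hn)).2
    rw [hv]
    have := mul_le_mul_of_nonneg_left (h1 n (by linarith)) (hγ0 n)
    linarith
  · obtain ⟨h3, h4⟩ := abs_lt.1 (hN n hn)
    have h5 := h2 (b + m n) ⟨by linarith, by linarith⟩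
    have h6 := hg (b + m n) (v n + m n) (by linarith)
    rw [hv]
    nlinarith [mul_nonneg (hγ0 n) (show 0 ≤ g (v n + m n) + (v n - b) by linarith),
      mul_nonneg (sub_nonneg.2 (hγ1 n)) (sub_nonneg.2 hle)]

lemma sum_range_ite_lt (f : ℕ → ℝ) {m n : ℕ} (h : m ≤ n) :
    ∑ k ∈ Finset.range n, (if k < m then 0 else f k) =
      ∑ k ∈ Finset.range n, f k - ∑ k ∈ Finset.range m, f k := by
  induction n, h using Nat.le_induction with
  | base =>
    rw [sub_self]
    exact Finset.sum_eq_zero fun k hk => if_pos (Finset.mem_range.1 hk)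
  | succ n hn ih =>
    rw [Finset.sum_range_succ, Finset.sum_range_succ, ih, if_neg (by omega)]
    ring

/-! ### Convergence to the stable equilibrium -/

lemma tendsto_logOdds_thetaPlus {r ρ α η : ℝ} (hr : r ∈ Ioo (1 : ℝ) 2)
    (hρ : ρ ∈ Ioo (criticalFidelity r) 1) (hα : α ∈ Ioc (1 / 2 : ℝ) 1) (hη : η ∈ Ioc (0 : ℝ) 1)
    {z ξ : ℕ → ℝ} (hz : ∀ n, z (n + 1) = z n + stepSize α η n * (drift r ρ (z n) + ξ n))
    {M : ℝ} (hM : Tendsto (fun n => ∑ k ∈ Finset.range n, stepSize α η k * ξ k) atTop (𝓝 M))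
    {a : ℝ} (ha : logOdds (thetaMinus r ρ) < a) (haz : ∀ n, a ≤ z n) :
    Tendsto z atTop (𝓝 (logOdds (thetaPlus r ρ))) := by
  have hρ' := half_lt_of_criticalFidelity_lt hρ
  have hg (x y : ℝ) (h : x ≤ y) := drift_sub_le hr hρ' h
  have hγ0 (n : ℕ) := (stepSize_pos hη α n).le
  have hγ1 := stepSize_le_one hα hη
  have hγ := tendsto_stepTime hα hη
  unfold stepTime at hγ
  set S : ℕ → ℝ := fun n => ∑ k ∈ Finset.range n, stepSize α η k * ξ k with hS
  set zp := logOdds (thetaPlus r ρ) with hzp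
  set v : ℕ → ℝ := fun n => z n - S n + M with hv
  set m : ℕ → ℝ := fun n => S n - M with hm
  have hm0 : Tendsto m atTop (𝓝 0) := by simpa using hM.sub_const M
  have hvm (n : ℕ) : v n + m n = z n := by simp only [hv, hm]; ring
  have hvs (n : ℕ) : v (n + 1) = v n + stepSize α η n * drift r ρ (v n + m n) := by
    rw [hvm]
    simp only [hv, hS, hz, Finset.sum_range_succ]
    ring
  have hlower (b : ℝ) (hb : b < zp) : ∀ᶠ n in atTop, b ≤ v n := by
    by_cases hazp : a < zp
    · set b' := max b ((a + zp) / 2) with hb'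
      have h1 : b' < zp := max_lt hb (by linarith)
      have h2 : (a + zp) / 2 ≤ b' := le_max_right _ _
      set τ := min ((zp - b') / 2) ((zp - a) / 2) with hτ
      have hτ0 : 0 < τ := lt_min (by linarith) (by linarith)
      have hτ1 : τ ≤ (zp - b') / 2 := min_le_left _ _
      have hτ2 : τ ≤ (zp - a) / 2 := min_le_right _ _
      obtain ⟨c, hc, hcd⟩ := exists_pos_le_drift hr hρ ha (b := b' + τ) (by linarith)
      filter_upwards [eventually_le_of_drift hg hγ0 hγ1 hγ hm0 hvs hc hτ0
        (fun n hn => hcd _ ⟨by rw [hvm]; exact haz n, hn⟩)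
        (fun y hy => hc.le.trans (hcd y ⟨by linarith [hy.1], hy.2⟩))] with n hn
      exact (le_max_left _ _).trans hn
    · filter_upwards [hm0.eventually_lt_const (show 0 < zp - b by linarith)] with n hn
      have := hvm n
      linarith [haz n]
  have hupper (b : ℝ) (hb : zp < b) : ∀ᶠ n in atTop, v n ≤ b := by
    obtain ⟨c, hc, hcd⟩ := exists_drift_le_neg hr hρ (b := (zp + b) / 2) (by linarith)
    have h := eventually_le_of_drift (g := fun x => -drift r ρ (-x)) (neg_drift_sub_le hg)
      (v := fun n => -v n) (m := fun n => -m n) hγ0 hγ1 hγ (by simpa using hm0.neg)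
      (fun n => by simp only [hvs, neg_add_rev, neg_neg, add_comm (m n)]; ring) (b := -b) hc
      (τ := (b - zp) / 2) (by linarith)
      (fun n hn => le_neg.1 (hcd _ (by linarith)))
      (fun y hy => by
        have := hcd (-y) (by linarith [hy.2])
        linarith)
    filter_upwards [h] with n hn
    linarith
  have hvt : Tendsto v atTop (𝓝 zp) := by
    refine tendsto_order.2 ⟨fun b hb => ?_, fun b hb => ?_⟩
    · filter_upwards [hlower ((b + zp) / 2) (by linarith)] with n hn
      linarith
    · filter_upwards [hupper ((b + zp) / 2) (by linarith)] with n hn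
      linarith
  simpa [hvm] using hvt.add hm0

/-! ### Almost sure convergence of the accumulated noise -/

lemma ae_exists_tendsto_sum_noise {r ρ α η : ℝ} (hr : r ∈ Ioo (1 : ℝ) 2)
    (hρ : ρ ∈ Ioo (1 / 2 : ℝ) 1) (hα : α ∈ Ioc (1 / 2 : ℝ) 1) {b : ℕ} (hb : 1 ≤ b) (θ₀ : ℝ) :
    ∀ᵐ ω ∂sampleMeasure, ∃ M, Tendsto
      (fun n => ∑ k ∈ Finset.range n, stepSize α η k * noise r ρ α η b θ₀ ω k) atTop (𝓝 M) := by
  set S : Sample → ℕ → ℝ := fun ω n =>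
    ∑ k ∈ Finset.range n, stepSize α η k * noise r ρ α η b θ₀ ω k with hS
  have hsum := summable_stepSize_sq hα η
  have hnull (x : ℝ) (hx : 0 < x) :
      sampleMeasure {ω | ∀ m, ∃ n ≥ m, x ≤ |S ω n - S ω m|} = 0 := by
    rw [← measureReal_eq_zero_iff]
    refine le_antisymm (le_of_forall_pos_le_add fun ε hε => ?_) measureReal_nonneg
    rw [zero_add]
    have h0 : 0 < 1 - ρ := by linarith [hρ.2]
    have hb0 : (0 : ℝ) < b := by positivity
    set K : ℝ := b * x ^ 2 / (2 * (4 / (1 - ρ)) ^ 2) with hK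
    have hK0 : 0 < K := by positivity
    set V : ℝ := ε * K / 2 with hVdef
    have hV : 0 < V := by positivity
    obtain ⟨m, hm⟩ := (hsum.hasSum.tendsto_sum_nat.eventually_const_lt
      (show ∑' n, stepSize α η n ^ 2 - V < ∑' n, stepSize α η n ^ 2 by linarith)).exists
    set c : ℕ → ℝ := fun k => if k < m then 0 else stepSize α η k with hc
    have hcsq (k : ℕ) : c k ^ 2 = if k < m then 0 else stepSize α η k ^ 2 := by
      simp only [hc]; split_ifs <;> simp
    have hcV (n : ℕ) : ∑ k ∈ Finset.range n, c k ^ 2 ≤ V := by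
      simp only [hcsq]
      refine (Finset.sum_le_sum_of_subset_of_nonneg
        (Finset.range_mono (le_max_right m n)) fun k _ _ => ?_).trans ?_
      · split_ifs
        · exact le_rfl
        · exact sq_nonneg _
      · rw [sum_range_ite_lt _ (le_max_left m n)]
        linarith [hsum.sum_le_tsum (Finset.range (max m n)) fun k _ => sq_nonneg _]
    have hmain := measureReal_exists_le_abs_sum_noise_le hr hρ α η hb θ₀ hV hcV hx
    have hsub : {ω | ∀ m, ∃ n ≥ m, x ≤ |S ω n - S ω m|} ⊆
        {ω | ∃ n, x ≤ |∑ k ∈ Finset.range n, c k * noise r ρ α η b θ₀ ω k|} := by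
      intro ω hω
      obtain ⟨n, hn, hxn⟩ := hω m
      refine ⟨n, hxn.trans_eq ?_⟩
      rw [hS, ← sum_range_ite_lt _ hn]
      simp only [hc, ite_mul, zero_mul]
    refine (measureReal_mono hsub).trans (hmain.trans ?_)
    have e : b * x ^ 2 / (2 * (4 / (1 - ρ)) ^ 2 * V) = 2 / ε := by
      rw [← div_div, ← hK, hVdef]
      field_simp
    rw [e, Real.exp_neg]
    have h2 : 2 / ε ≤ Real.exp (2 / ε) := by linarith [Real.add_one_le_exp (2 / ε)]
    calc 2 * (Real.exp (2 / ε))⁻¹ ≤ 2 * (2 / ε)⁻¹ := by gcongr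
      _ = ε := by field_simp
  have hall : ∀ᵐ ω ∂sampleMeasure, ∀ j : ℕ, ¬ ∀ m, ∃ n ≥ m, 1 / ((j : ℝ) + 1) ≤ |S ω n - S ω m| :=
    ae_all_iff.2 fun j => by
      rw [ae_iff]
      simpa only [not_not] using hnull _ (by positivity)
  filter_upwards [hall] with ω hω
  refine cauchySeq_tendsto_of_complete (Metric.cauchySeq_iff'.2 fun ε hε => ?_)
  obtain ⟨j, hj⟩ := exists_nat_one_div_lt hε
  have := hω j
  push Not at this
  obtain ⟨m, hm⟩ := this
  exact ⟨m, fun n hn => (hm n hn).trans hj⟩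

/-! ### Equilibrium selection -/

lemma le_logOdds_sub {θ θ' : ℝ} (hθ : θ ∈ Ioo (0 : ℝ) 1) (hθ' : θ' ∈ Ioo (0 : ℝ) 1)
    (h : θ ≤ θ') : θ' - θ ≤ logOdds θ' - logOdds θ := by
  have h1 := abs_sigmoid_sub_le (logOdds θ') (logOdds θ)
  rw [sigmoid_logOdds hθ, sigmoid_logOdds hθ', abs_of_nonneg (sub_nonneg.2 h)] at h1
  rwa [abs_of_nonneg] at h1
  rw [sub_nonneg, ← Real.sigmoid_le_iff, sigmoid_logOdds hθ, sigmoid_logOdds hθ']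
  exact h

/-- The probability of selecting the wrong equilibrium is sub-Gaussian in the distance of the initial
propensity from the separatrix, uniformly in the initial propensity. -/
theorem exists_collusionProb_bound {r ρ α η : ℝ} (hr : r ∈ Ioo (1 : ℝ) 2)
    (hρ : ρ ∈ Ioo (criticalFidelity r) 1) (hα : α ∈ Ioc (1 / 2 : ℝ) 1)
    (hη : η ∈ Ioc (0 : ℝ) 1) :
    ∃ c > 0, ∀ b : ℕ, 1 ≤ b → ∀ θ₀ ∈ Ioo (0 : ℝ) 1,
      (thetaMinus r ρ < θ₀ → 1 - collusionProb r ρ α η b θ₀ ≤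
        2 * Real.exp (-c * b * (θ₀ - thetaMinus r ρ) ^ 2)) ∧
      (θ₀ < thetaMinus r ρ → collusionProb r ρ α η b θ₀ ≤
        2 * Real.exp (-c * b * (θ₀ - thetaMinus r ρ) ^ 2)) := by
  have hρ' := half_lt_of_criticalFidelity_lt hρ
  have hg (x y : ℝ) (h : x ≤ y) := drift_sub_le hr hρ' h
  have hγ0 (n : ℕ) := (stepSize_pos hη α n).le
  have hγ1 := stepSize_le_one hα hη
  have hsum := summable_stepSize_sq hα η
  have htm := thetaMinus_mem hr hρ
  have htp := thetaPlus_mem hr hρ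
  set V := ∑' n, stepSize α η n ^ 2
  have hV : 0 < V := hsum.tsum_pos (fun n => sq_nonneg _) 0 (pow_pos (stepSize_pos hη α 0) 2)
  have hcV (n : ℕ) : ∑ k ∈ Finset.range n, stepSize α η k ^ 2 ≤ V :=
    hsum.sum_le_tsum _ fun k _ => sq_nonneg _
  set zm := logOdds (thetaMinus r ρ) with hzm
  set zp := logOdds (thetaPlus r ρ) with hzp
  have hzlt : 0 < zp - zm := by
    linarith [le_logOdds_sub htm htp (thetaMinus_lt_thetaPlus hr hρ).le,
      thetaMinus_lt_thetaPlus hr hρ]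
  set κ := min 1 (zp - zm) with hκ
  have hκ0 : 0 < κ := lt_min one_pos hzlt
  have hκ1 : κ ≤ 1 := min_le_left _ _
  have hκ2 : κ ≤ zp - zm := min_le_right _ _
  have h0 : 0 < 1 - ρ := by linarith [hρ'.2]
  refine ⟨κ ^ 2 / (32 * (4 / (1 - ρ)) ^ 2 * V), by positivity, fun b hb θ₀ hθ₀ => ?_⟩
  have hexit (d : ℝ) (hd : 0 < d) (hd2 : d ^ 2 = (θ₀ - thetaMinus r ρ) ^ 2) :
      sampleMeasure.real {ω | ∃ n, κ * d / 4 ≤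
        |∑ k ∈ Finset.range n, stepSize α η k * noise r ρ α η b θ₀ ω k|} ≤
      2 * Real.exp (-(κ ^ 2 / (32 * (4 / (1 - ρ)) ^ 2 * V)) * b *
        (θ₀ - thetaMinus r ρ) ^ 2) := by
    refine (measureReal_exists_le_abs_sum_noise_le hr hρ' α η hb θ₀ hV hcV
      (x := κ * d / 4) (by positivity)).trans (le_of_eq ?_)
    rw [← hd2]
    congr 2
    field_simp
    ring
  constructor
  · intro hlt
    set d := θ₀ - thetaMinus r ρ with hd
    have hd0 : 0 < d := sub_pos.2 hlt
    have hd1 : d ≤ 1 := by linarith [hθ₀.2, htm.1]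
    have hz0 : d ≤ logOdds θ₀ - zm := le_logOdds_sub htm hθ₀ hlt.le
    have hκd : κ * d ≤ d := mul_le_of_le_one_left hd0.le hκ1
    have hκd' : κ * d ≤ zp - zm := (mul_le_of_le_one_right hκ0.le hd1).trans hκ2
    have hκd0 : 0 < κ * d := mul_pos hκ0 hd0
    refine le_trans ?_ (hexit d hd0 rfl)
    set F := {ω | ∃ n, κ * d / 4 ≤
        |∑ k ∈ Finset.range n, stepSize α η k * noise r ρ α η b θ₀ ω k|}
    set N := {ω | ¬ ∃ M, Tendsto (fun n => ∑ k ∈ Finset.range n,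
      stepSize α η k * noise r ρ α η b θ₀ ω k) atTop (𝓝 M)}
    have hN : sampleMeasure.real N = 0 := by
      rw [measureReal_def, ae_iff.1 (ae_exists_tendsto_sum_noise hr hρ' hα hb θ₀)]
      rfl
    have hcover : (univ : Set Sample) ⊆ {ω | Tendsto
        (fun n => Real.sigmoid (logOddsPath r ρ α η b θ₀ ω n)) atTop (𝓝 (thetaPlus r ρ))} ∪
        (F ∪ N) := by
      intro ω _
      by_cases hF : ω ∈ F
      · exact Or.inr (Or.inl hF)
      by_cases hNω : ω ∈ N
      · exact Or.inr (Or.inr hNω)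
      left
      obtain ⟨M, hM⟩ := not_not.1 hNω
      have hsmall (n : ℕ) : |∑ k ∈ Finset.range n,
          stepSize α η k * noise r ρ α η b θ₀ ω k| ≤ κ * d / 4 := by
        by_contra! hcon
        exact hF ⟨n, hcon.le⟩
      have hbar := le_sub_of_barrier hg hγ0 hγ1 (logOddsPath_succ r ρ α η b θ₀ ω)
        (a := zm + κ * d / 2) (by simp only [logOddsPath]; linarith) hsmall
        (fun y hy => drift_nonneg hr hρ (by linarith [hy.1]) (by linarith [hy.2]))
      have ht := tendsto_logOdds_thetaPlus hr hρ hα hη (logOddsPath_succ r ρ α η b θ₀ ω) hM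
        (a := zm + κ * d / 4) (by linarith)
        (fun n => by linarith [hbar n, (abs_le.1 (hsmall n)).1])
      have := (continuous_sigmoid.tendsto zp).comp ht
      rwa [sigmoid_logOdds htp] at this
    have h1 := measureReal_mono (μ := sampleMeasure) hcover
    rw [probReal_univ] at h1
    have h2 := measureReal_union_le (μ := sampleMeasure) F N
    have h3 := h1.trans (measureReal_union_le _ _)
    rw [collusionProb]
    linarith
  · intro hlt
    set d := thetaMinus r ρ - θ₀ with hd
    have hd0 : 0 < d := sub_pos.2 hlt
    have hz0 : d ≤ zm - logOdds θ₀ := le_logOdds_sub hθ₀ htm hlt.le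
    have hκd : κ * d ≤ d := mul_le_of_le_one_left hd0.le hκ1
    have hκd0 : 0 < κ * d := mul_pos hκ0 hd0
    refine le_trans (measureReal_mono fun ω hω => ?_) (hexit d hd0 (by rw [hd]; ring))
    by_contra hF
    have hsmall (n : ℕ) : |∑ k ∈ Finset.range n,
        stepSize α η k * noise r ρ α η b θ₀ ω k| ≤ κ * d / 4 := by
      by_contra! hcon
      exact hF ⟨n, hcon.le⟩
    have hbar := sub_le_of_barrier hg hγ0 hγ1 (logOddsPath_succ r ρ α η b θ₀ ω)
      (a := zm - κ * d / 2) (by simp only [logOddsPath]; linarith) hsmall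
      (fun y hy => drift_nonpos_of_le hr hρ (by linarith [hy.2]))
    have hle : thetaPlus r ρ ≤ thetaMinus r ρ := by
      refine le_of_tendsto hω (Eventually.of_forall fun n => ?_)
      rw [← sigmoid_logOdds htm]
      exact Real.sigmoid_le (by linarith [hbar n, (abs_le.1 (hsmall n)).2])
    exact absurd (thetaMinus_lt_thetaPlus hr hρ) (not_lt.2 hle)

/-! ### Finite-horizon tracking -/

lemma abs_interpolate_sub_le {γ : ℕ → ℝ} (hγ : ∀ n, 0 < γ n) {T : ℝ} {N : ℕ}
    (hN : T < stepTime γ N) {z z' : ℕ → ℝ} {x : ℝ} (hx : ∀ n ≤ N, |z n - z' n| ≤ x) {t : ℝ}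
    (ht : t ∈ Icc 0 T) : |interpolate γ z t - interpolate γ z' t| ≤ x := by
  have hmono : Monotone (stepTime γ) := monotone_nat_of_le_succ fun n => by
    rw [stepTime, stepTime, Finset.sum_range_succ]
    linarith [hγ n]
  have hlt (n : ℕ) (hn : stepTime γ n ≤ t) : n < N := by
    by_contra! h
    linarith [hmono h, ht.2]
  have hbdd : BddAbove {n | stepTime γ n ≤ t} := ⟨N, fun n hn => (hlt n hn).le⟩
  have hmem : sSup {n | stepTime γ n ≤ t} ∈ {n | stepTime γ n ≤ t} :=
    Nat.sSup_mem ⟨0, by simpa [stepTime] using ht.1⟩ hbdd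
  have hnext : t < stepTime γ (sSup {n | stepTime γ n ≤ t} + 1) := by
    by_contra! h
    have := le_csSup hbdd (show _ ∈ {n | stepTime γ n ≤ t} from h)
    omega
  simp only [interpolate]
  set n := sSup {n | stepTime γ n ≤ t}
  have hnN := hlt n hmem
  have hstep : stepTime γ (n + 1) = stepTime γ n + γ n := Finset.sum_range_succ _ _
  set l := (t - stepTime γ n) / γ n with hl
  have hl0 : 0 ≤ l := div_nonneg (sub_nonneg.2 hmem) (hγ n).le
  have hl1 : l ≤ 1 := (div_le_one (hγ n)).2 (by linarith)
  have h1 := abs_le.1 (hx n hnN.le)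
  have h2 := abs_le.1 (hx (n + 1) hnN)
  rw [abs_le]
  constructor <;> nlinarith

lemma abs_sub_det_le {r ρ α η : ℝ} (hr : r ∈ Ioo (1 : ℝ) 2) (hρ : ρ ∈ Ioo (1 / 2 : ℝ) 1)
    (hα : α ∈ Ioc (1 / 2 : ℝ) 1) (hη : η ∈ Ioc (0 : ℝ) 1) (b : ℕ) (θ₀ : ℝ) (ω : Sample) {N : ℕ}
    {x : ℝ} (hx : ∀ k < N, |noise r ρ α η b θ₀ ω k| ≤ x) {n : ℕ} (hn : n ≤ N) :
    |logOddsPath r ρ α η b θ₀ ω n - detLogOddsPath r ρ α η θ₀ n| ≤ (2 ^ n - 1) * x := by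
  induction n with
  | zero => simp [logOddsPath, detLogOddsPath]
  | succ n ih =>
    have h1 := ih (by omega)
    have h2 := hx n (by omega)
    have h3 := abs_drift_sub_le hr hρ (logOddsPath r ρ α η b θ₀ ω n) (detLogOddsPath r ρ α η θ₀ n)
    rw [logOddsPath_succ, detLogOddsPath, ← drift]
    set z := logOddsPath r ρ α η b θ₀ ω n
    set y := detLogOddsPath r ρ α η θ₀ n
    set ξ := noise r ρ α η b θ₀ ω n
    calc |z + stepSize α η n * (drift r ρ z + ξ) - (y + stepSize α η n * drift r ρ y)|
        = |(z - y) + stepSize α η n * ((drift r ρ z - drift r ρ y) + ξ)| := by congr 1; ring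
      _ ≤ |z - y| + 1 * (|drift r ρ z - drift r ρ y| + |ξ|) := by
        refine (abs_add_le _ _).trans ?_
        rw [abs_mul, abs_of_pos (stepSize_pos hη α n)]
        gcongr
        · exact stepSize_le_one hα hη n
        · exact abs_add_le _ _
      _ ≤ (2 ^ (n + 1) - 1) * x := by
        rw [pow_succ]
        linarith

theorem exists_pathDeviation_bound {r ρ α η : ℝ} (hr : r ∈ Ioo (1 : ℝ) 2)
    (hρ : ρ ∈ Ioo (1 / 2 : ℝ) 1) (hα : α ∈ Ioc (1 / 2 : ℝ) 1) (hη : η ∈ Ioc (0 : ℝ) 1) {T : ℝ}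
    (hT : 0 < T) :
    ∃ C : ℝ, 0 < C ∧ ∀ b : ℕ, 1 ≤ b → ∀ θ₀ : ℝ, ∀ ε : ℝ, 0 < ε →
      sampleMeasure.real {ω | ε < pathDeviation r ρ α η b θ₀ T ω} ≤ C / (b * ε ^ 2) := by
  obtain ⟨N, hN⟩ := ((tendsto_stepTime hα hη).eventually_gt_atTop T).exists
  have h0 : 0 < 1 - ρ := by linarith [hρ.2]
  refine ⟨16 * (4 / (1 - ρ)) ^ 2 * (N + 1) * (2 ^ N) ^ 2, by positivity,
    fun b hb θ₀ ε hε => ?_⟩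
  have hb0 : (0 : ℝ) < b := by positivity
  set x := ε / 2 ^ N with hx
  have hx0 : 0 < x := by positivity
  have hV (n : ℕ) : ∑ k ∈ Finset.range n, (if k < N then (1 : ℝ) else 0) ^ 2 ≤ N + 1 := by
    simp only [ite_pow, one_pow, ne_eq, OfNat.ofNat_ne_zero, not_false_eq_true, zero_pow]
    rw [← Finset.sum_filter, Finset.sum_const, nsmul_eq_mul, mul_one]
    have : ((Finset.range n).filter fun k => k < N).card ≤ N := by
      refine (Finset.card_le_card (t := Finset.range N) fun k hk => ?_).trans
        (Finset.card_range N).le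
      exact Finset.mem_range.2 (Finset.mem_filter.1 hk).2
    exact_mod_cast this.trans N.le_succ
  have hmax := measureReal_exists_le_abs_sum_noise_le hr hρ α η hb θ₀ (V := N + 1)
    (by positivity) hV (x := x / 2) (by positivity)
  refine (measureReal_mono fun ω hω => ?_).trans (hmax.trans ?_)
  · by_contra hcon
    simp only [mem_ofPred_eq, not_exists, not_le] at hcon
    have hξ (k : ℕ) (hk : k < N) : |noise r ρ α η b θ₀ ω k| ≤ x := by
      have h1 := abs_lt.1 (hcon k)
      have h2 := abs_lt.1 (hcon (k + 1))
      rw [Finset.sum_range_succ, if_pos hk, one_mul] at h2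
      exact abs_le.2 ⟨by linarith [h1.2, h2.1], by linarith [h1.1, h2.2]⟩
    have hpath (n : ℕ) (hn : n ≤ N) :
        |logOddsPath r ρ α η b θ₀ ω n - detLogOddsPath r ρ α η θ₀ n| ≤ ε := by
      refine (abs_sub_det_le hr hρ hα hη b θ₀ ω hξ hn).trans ?_
      have h2 : (2 : ℝ) ^ n ≤ 2 ^ N := pow_le_pow_right₀ (by norm_num) hn
      calc ((2 : ℝ) ^ n - 1) * x ≤ 2 ^ N * x := by gcongr; linarith
        _ = ε := by rw [hx]; field_simp
    have : Nonempty (Icc (0 : ℝ) T) := ⟨⟨0, le_rfl, hT.le⟩⟩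
    refine absurd (show pathDeviation r ρ α η b θ₀ T ω ≤ ε from ciSup_le fun t => ?_) (not_le.2 hω)
    exact (abs_sigmoid_sub_le _ _).trans
      (abs_interpolate_sub_le (stepSize_pos hη α) hN hpath t.2)
  · set u := b * (x / 2) ^ 2 / (2 * (4 / (1 - ρ)) ^ 2 * ((N : ℝ) + 1)) with hu
    have hu0 : 0 < u := by positivity
    rw [Real.exp_neg]
    have h2 : u ≤ Real.exp u := by linarith [Real.add_one_le_exp u]
    calc 2 * (Real.exp u)⁻¹ ≤ 2 * u⁻¹ := by gcongr
      _ = _ := by rw [hu, hx]; field_simp; ring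

lemma exists_pathDeviation_quantile {r ρ α η : ℝ} (hr : r ∈ Ioo (1 : ℝ) 2)
    (hρ : ρ ∈ Ioo (1 / 2 : ℝ) 1) (hα : α ∈ Ioc (1 / 2 : ℝ) 1) (hη : η ∈ Ioc (0 : ℝ) 1) {T : ℝ}
    (hT : 0 < T) {κ : ℝ} (hκ : 0 < κ) :
    ∃ M : ℝ, ∀ b : ℕ, 1 ≤ b → ∀ θ₀ : ℝ,
      sampleMeasure.real {ω | M / √(b : ℝ) < pathDeviation r ρ α η b θ₀ T ω} ≤ κ := by
  obtain ⟨C, hC, h⟩ := exists_pathDeviation_bound hr hρ hα hη hT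
  refine ⟨√(C / κ), fun b hb θ₀ => ?_⟩
  have hb0 : (0 : ℝ) < b := by positivity
  refine (h b hb θ₀ _ (by positivity)).trans (le_of_eq ?_)
  rw [div_pow, Real.sq_sqrt (by positivity), Real.sq_sqrt hb0.le]
  field_simp

/-! ### Consequences of the selection bound -/

lemma tendsto_two_mul_exp_neg {c d : ℝ} (hc : 0 < c) (hd : d ≠ 0) :
    Tendsto (fun b : ℕ => 2 * Real.exp (-c * b * d ^ 2)) atTop (𝓝 0) := by
  have hcd : 0 < c * d ^ 2 := by positivity
  have h := (Real.tendsto_exp_neg_atTop_nhds_zero.comp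
    (tendsto_natCast_atTop_atTop.const_mul_atTop hcd)).const_mul 2
  rw [mul_zero] at h
  refine h.congr fun b => ?_
  simp only [Function.comp]
  congr 2
  ring

lemma abs_le_div_sqrt_of_lt {ε c d : ℝ} (hε : ε ∈ Ioo (0 : ℝ) (1 / 2)) (hc : 0 < c) {b : ℕ}
    (hb : 1 ≤ b) (h : ε < 2 * Real.exp (-c * b * d ^ 2)) :
    |d| ≤ √(Real.log (2 / ε) / c) / √(b : ℝ) := by
  have hb0 : (0 : ℝ) < b := by positivity
  rw [← Real.sqrt_div' _ hb0.le]
  refine Real.le_sqrt_of_sq_le ?_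
  rw [sq_abs, le_div_iff₀ hb0, le_div_iff₀ hc]
  have h1 : Real.exp (c * b * d ^ 2) < 2 / ε := by
    rw [lt_div_iff₀ hε.1]
    have h2 : Real.exp (c * b * d ^ 2) * Real.exp (-c * b * d ^ 2) = 1 := by
      rw [← Real.exp_add]; simp
    nlinarith [mul_lt_mul_of_pos_left h (Real.exp_pos (c * b * d ^ 2))]
  have h3 := (Real.lt_log_iff_exp_lt (div_pos two_pos hε.1)).2 h1
  linarith

lemma collusionProb_mem (r ρ α η : ℝ) (b : ℕ) (θ₀ : ℝ) :
    collusionProb r ρ α η b θ₀ ∈ Icc (0 : ℝ) 1 :=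
  ⟨measureReal_nonneg, measureReal_le_one⟩

end LLMPricing

theorem mainTheorem4 (r ρ α η : ℝ) (hr : r ∈ Set.Ioo (1 : ℝ) 2)
    (hρ : ρ ∈ Set.Ioo (LLMPricing.criticalFidelity r) 1)
    (hα : α ∈ Set.Ioc (1 / 2 : ℝ) 1) (hη : η ∈ Set.Ioc (0 : ℝ) 1) :
    -- (i) finite-horizon tracking, with a constant independent of `b`, `θ₀` and `ε`
    (∀ T : ℝ, 0 < T → ∃ C : ℝ, ∀ b : ℕ, 1 ≤ b → ∀ θ₀ ∈ Set.Ioo (0 : ℝ) 1, ∀ ε : ℝ, 0 < ε →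
      LLMPricing.sampleMeasure.real {ω | ε < LLMPricing.pathDeviation r ρ α η b θ₀ T ω}
        ≤ C / (b * ε ^ 2)) ∧
    -- in particular the deviation is `O_p(1 / √b)`
    (∀ T : ℝ, 0 < T → ∀ κ : ℝ, 0 < κ → ∃ M : ℝ, ∀ b : ℕ, 1 ≤ b → ∀ θ₀ ∈ Set.Ioo (0 : ℝ) 1,
      LLMPricing.sampleMeasure.real {ω | M / √(b : ℝ) < LLMPricing.pathDeviation r ρ α η b θ₀ T ω}
        ≤ κ) ∧
    -- (ii) lock-in away from the separatrix
    (∀ δ ∈ Set.Ioo (0 : ℝ) (1 / 2), ∃ c C : ℝ, 0 < c ∧ ∀ b : ℕ, 1 ≤ b →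
      (∀ θ₀ ∈ Set.Icc (LLMPricing.thetaMinus r ρ + δ) (1 - δ),
        1 - LLMPricing.collusionProb r ρ α η b θ₀ ≤ C * Real.exp (-c * b * δ ^ 2)) ∧
      (∀ θ₀ ∈ Set.Icc δ (LLMPricing.thetaMinus r ρ - δ),
        LLMPricing.collusionProb r ρ α η b θ₀ ≤ C * Real.exp (-c * b * δ ^ 2))) ∧
    -- the large-batch limit of the collusion probability
    (∀ θ₀ ∈ Set.Ioo (0 : ℝ) 1, θ₀ ≠ LLMPricing.thetaMinus r ρ →
      Filter.Tendsto (fun b : ℕ => LLMPricing.collusionProb r ρ α η b θ₀) Filter.atTop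
        (nhds (if LLMPricing.thetaMinus r ρ < θ₀ then 1 else 0))) ∧
    -- (iii) width of the transition region
    (∀ ε ∈ Set.Ioo (0 : ℝ) (1 / 2), ∀ δ₀ ∈ Set.Ioo (0 : ℝ) (1 / 2),
      LLMPricing.thetaMinus r ρ ∈ Set.Ioo δ₀ (1 - δ₀) →
      ∃ K : ℝ, 0 < K ∧ ∀ b : ℕ, 1 ≤ b → ∀ θ₀ ∈ Set.Icc δ₀ (1 - δ₀),
        LLMPricing.collusionProb r ρ α η b θ₀ ∈ Set.Ioo ε (1 - ε) →
        |θ₀ - LLMPricing.thetaMinus r ρ| ≤ K / √(b : ℝ)) := by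
  have hρ' := LLMPricing.half_lt_of_criticalFidelity_lt hρ
  obtain ⟨c, hc, hsel⟩ := LLMPricing.exists_collusionProb_bound hr hρ hα hη
  refine ⟨fun T hT => ?_, fun T hT κ hκ => ?_, fun δ hδ => ?_, fun θ₀ hθ₀ hne => ?_,
    fun ε hε δ₀ hδ₀ _ => ?_⟩
  · obtain ⟨C, _, h⟩ := LLMPricing.exists_pathDeviation_bound hr hρ' hα hη hT
    exact ⟨C, fun b hb θ₀ _ ε hε => h b hb θ₀ ε hε⟩
  · obtain ⟨M, h⟩ := LLMPricing.exists_pathDeviation_quantile hr hρ' hα hη hT hκ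
    exact ⟨M, fun b hb θ₀ _ => h b hb θ₀⟩
  · have htm := LLMPricing.thetaMinus_mem hr hρ
    have hexp (b : ℕ) (d : ℝ) (hd : δ ^ 2 ≤ d ^ 2) :
        2 * Real.exp (-c * b * d ^ 2) ≤ 2 * Real.exp (-c * b * δ ^ 2) := by
      have := mul_le_mul_of_nonneg_left hd (mul_nonneg hc.le (Nat.cast_nonneg (α := ℝ) b))
      gcongr ?_ * Real.exp ?_
      linarith
    refine ⟨c, 2, hc, fun b hb => ⟨fun θ₀ hθ₀ => ?_, fun θ₀ hθ₀ => ?_⟩⟩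
    · refine ((hsel b hb θ₀ ⟨?_, ?_⟩).1 ?_).trans (hexp b _ ?_)
      · linarith [hθ₀.1, htm.1, hδ.1]
      · linarith [hθ₀.2, hδ.1]
      · linarith [hθ₀.1, hδ.1]
      · exact pow_le_pow_left₀ hδ.1.le (by linarith [hθ₀.1]) 2
    · refine ((hsel b hb θ₀ ⟨?_, ?_⟩).2 ?_).trans (hexp b _ ?_)
      · linarith [hθ₀.1, hδ.1]
      · linarith [hθ₀.2, htm.2, hδ.1]
      · linarith [hθ₀.2, hδ.1]
      · rw [← neg_sub, neg_sq]
        exact pow_le_pow_left₀ hδ.1.le (by linarith [hθ₀.2]) 2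
  · have hlim := LLMPricing.tendsto_two_mul_exp_neg hc (sub_ne_zero.2 hne)
    split_ifs with hlt
    · refine tendsto_of_tendsto_of_tendsto_of_le_of_le'
        (by simpa only [sub_zero] using hlim.const_sub 1) tendsto_const_nhds ?_
        (Filter.Eventually.of_forall fun b => (LLMPricing.collusionProb_mem r ρ α η b θ₀).2)
      filter_upwards [Filter.eventually_ge_atTop 1] with b hb
      linarith [(hsel b hb θ₀ hθ₀).1 hlt]
    · refine tendsto_of_tendsto_of_tendsto_of_le_of_le' tendsto_const_nhds hlim
        (Filter.Eventually.of_forall fun b => (LLMPricing.collusionProb_mem r ρ α η b θ₀).1) ?_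
      filter_upwards [Filter.eventually_ge_atTop 1] with b hb
      exact (hsel b hb θ₀ hθ₀).2 (lt_of_le_of_ne (not_lt.1 hlt) hne)
  · have hlog : 0 < Real.log (2 / ε) := by
      refine Real.log_pos ?_
      rw [one_lt_div hε.1]
      linarith [hε.2]
    refine ⟨√(Real.log (2 / ε) / c), Real.sqrt_pos.2 (div_pos hlog hc), fun b hb θ₀ hθ₀ hp => ?_⟩
    have hθ : θ₀ ∈ Set.Ioo (0 : ℝ) 1 := ⟨by linarith [hδ₀.1, hθ₀.1], by linarith [hδ₀.1, hθ₀.2]⟩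
    rcases lt_trichotomy θ₀ (LLMPricing.thetaMinus r ρ) with hlt | heq | hgt
    · exact LLMPricing.abs_le_div_sqrt_of_lt hε hc hb (hp.1.trans_le ((hsel b hb θ₀ hθ).2 hlt))
    · rw [heq, sub_self, abs_zero]
      positivity
    · refine LLMPricing.abs_le_div_sqrt_of_lt hε hc hb (lt_of_lt_of_le ?_ ((hsel b hb θ₀ hθ).1 hgt))
      linarith [hp.2]
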